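/- **Setting.** A two-player equal $\theta$-sharing game has players $1,2$ with budgets $B_1,B_2>0$ and projects $\Omega=\{1,\dots,m\}$, $m\ge 1$, with coefficients $\alpha_j>0$. A strategy of player $i$ is a vector $x^i=(x^i_\omega)_{\omega\in\Omega}$ of nonnegative reals with $\sum_{\omega} x^i_\omega\le B_i$. Project $\omega$ has the value $\alpha_\omega\,(x^1_\omega+x^2_\omega)$, which is divided equally among those players whose contribution to $\omega$ is at least $\theta$ times the largest contribution to $\omega$; the other players get nothing from $\omega$. The utility of a player is the sum of her shares over all projects, and the social welfare is the sum of the utilities. A Nash equilibrium (NE) is a pure strategy NE. The price of anarchy $\mathrm{PoA}$ (price of stability $\mathrm{PoS}$) is the ratio of the welfare of a worst (best) NE to the largest welfare of any strategy profile; the statements below include that these worst and best NE and this optimum exist. **Theorem.** Let $0<\theta<1$ and $0<B_1\le B_2$, and let, for some $1\le k\le m$, $$\alpha_m=\alpha_{m-1}=\dots=\alpha_{m-k+1}>\alpha_{m-k}\ge\alpha_{m-k-1}\ge\dots\ge\alpha_1>0$$ (for $k=m$ all coefficients are equal). The projects with the largest coefficient are called steep, and a $2$-steep project is a non-steep project whose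 coefficient is largest among the non-steep projects. 1. Assume $B_1\ge\theta B_2$, $B_1\ge k\theta B_2$, and, if $k<m$, also $\tfrac12\alpha_m\ge\alpha_{m-k}$. Then an NE exists, and $\mathrm{PoS}=\mathrm{PoA}=1$. 2. Assume $B_1<\theta B_2$. Consider the conditions (a) $k<m$, $B_1<\frac{\theta B_2}{k}$, and $\frac{\alpha_{m-k}}{\alpha_m}\le\min\left\{\frac1{1+\theta},\frac{2\theta}{1+\theta}\right\}$; (b) $k<m$, $B_1<\frac{\theta B_2}{k+\theta^2}$, $\alpha_{m-k}\ge2\alpha_{m-k-1}$ (void if $m-k=1$), $\frac{2\theta}{1+\theta}\le\frac{\alpha_{m-k}}{\alpha_m}\le\frac{2(1-\theta)}{2-\theta}$, and $m-k$ is the only $2$-steep project; (c) $B_1<\frac{\theta}{m}B_2$ and $\alpha_m=\alpha_1$ (all project functions are equal); and the numbers $$R=\frac{\alpha_mB_2+\alpha_{m-k}B_1}{\alpha_m(B_1+B_2)},\qquad R'=\frac{\alpha_m(B_2-\theta B_1)+\alpha_{m-k}B_1(1+\theta)}{\alpha_m(B_1+B_2)}.$$ - If (a) holds, then an NE exists and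 $\mathrm{PoS}=R$; moreover $\mathrm{PoA}=R'$ if (b) holds as well, and $\mathrm{PoA}=\mathrm{PoS}=R$ otherwise. - If (b) holds, then an NE exists and $\mathrm{PoA}=R'$; moreover $\mathrm{PoS}=R$ if (a) holds as well, and $\mathrm{PoS}=R'$ otherwise. - If (c) holds, then an NE exists, $\mathrm{PoS}=1$, and $\mathrm{PoA}=\frac{B_2}{B_1+B_2}$. -/

import Mathlib

noncomputable section

/-- The data of a shared effort game with linear project functions and equal sharing with a
threshold: players `N`, projects `Ω`, player budgets, coefficients of the project functions
`P_ω(y) = coeff ω * y`, and the sharing threshold `θ`. -/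
structure SharedEffortGame (N Ω : Type*) where
  budget : N → ℝ
  coeff : Ω → ℝ
  threshold : ℝ

namespace SharedEffortGame

variable {N Ω : Type*} [Fintype N] [Fintype Ω] (G : SharedEffortGame N Ω)

/-- The strategy set of player `i`: nonnegative contributions of total at most the budget. -/
def strategySet (i : N) : Set (Ω → ℝ) :=
  {y | (∀ ω, 0 ≤ y ω) ∧ ∑ ω, y ω ≤ G.budget i}

/-- The strategy profiles of the game. -/
def profiles : Set (N → Ω → ℝ) :=
  {x | ∀ i, x i ∈ G.strategySet i}

/-- The value `P_ω(x_ω)` of project `ω`, where `x_ω` is its total contribution. -/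
def projectValue (x : N → Ω → ℝ) (ω : Ω) : ℝ :=
  G.coeff ω * ∑ i, x i ω

open Classical in
/-- The players who get a share of project `ω`: those whose bid is at least the fraction `θ` of
every bid, that is, of the maximum bid. If nobody contributes to `ω`, the value shared is `0`. -/
def sharers (x : N → Ω → ℝ) (ω : Ω) : Finset N :=
  {i | ∀ j, G.threshold * x j ω ≤ x i ω}

open Classical in
/-- The `θ`-equal sharing mechanism: the share of player `i` in project `ω`. -/
def share (x : N → Ω → ℝ) (i : N) (ω : Ω) : ℝ :=
  if i ∈ G.sharers x ω then G.projectValue x ω / ((G.sharers x ω).card : ℝ) else 0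

/-- The utility of player `i`. -/
def utility (x : N → Ω → ℝ) (i : N) : ℝ :=
  ∑ ω, G.share x i ω

/-- The social welfare: the total utility of the players. -/
def welfare (x : N → Ω → ℝ) : ℝ :=
  ∑ i, G.utility x i

open Classical in
/-- Pure strategy Nash equilibria. -/
def IsNash (x : N → Ω → ℝ) : Prop :=
  x ∈ G.profiles ∧
    ∀ i, ∀ y ∈ G.strategySet i, G.utility (Function.update x i y) i ≤ G.utility x i

/-- `r` is the price of anarchy: the ratio of the welfare of a worst pure Nash equilibrium to
the optimal welfare. Both extrema have to be attained, and the optimum has to be positive. -/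
def IsPriceOfAnarchy (r : ℝ) : Prop :=
  ∃ worst opt : ℝ, IsLeast (G.welfare '' {x | G.IsNash x}) worst ∧
    IsGreatest (G.welfare '' G.profiles) opt ∧ 0 < opt ∧ r = worst / opt

/-- `r` is the price of stability: the ratio of the welfare of a best pure Nash equilibrium to
the optimal welfare. Both extrema have to be attained, and the optimum has to be positive. -/
def IsPriceOfStability (r : ℝ) : Prop :=
  ∃ best opt : ℝ, IsGreatest (G.welfare '' {x | G.IsNash x}) best ∧
    IsGreatest (G.welfare '' G.profiles) opt ∧ 0 < opt ∧ r = best / opt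

/-- A project is steep if its coefficient is the largest one. -/
def IsSteep (ω : Ω) : Prop :=
  ∀ ω', G.coeff ω' ≤ G.coeff ω

/-- A project is `2`-steep if it is a most valuable non-steep project. -/
def IsTwoSteep (ω : Ω) : Prop :=
  ¬ G.IsSteep ω ∧ ∀ ω', ¬ G.IsSteep ω' → G.coeff ω' ≤ G.coeff ω

end SharedEffortGame

/-- The two-player equal `θ`-sharing game with budgets `B₁, B₂` (player `0 : Fin 2` has `B₁`)
and projects `1, …, m`, where project `j` has the project function `P_j(y) = α j * y`. -/
def twoPlayerGame (θ B₁ B₂ : ℝ) (m : ℕ) (α : ℕ → ℝ) :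
    SharedEffortGame (Fin 2) (Finset.Icc 1 m) where
  budget := ![B₁, B₂]
  coeff := fun j => α j
  threshold := θ

/-- A non-steep project exists, `B₁ < θ B₂ / k`, and `α_{m-k} / α_m` is at most
`1 / (1 + θ)` and `2θ / (1 + θ)`. -/
def SeparateCase (θ B₁ B₂ : ℝ) (m k : ℕ) (α : ℕ → ℝ) : Prop :=
  k < m ∧ B₁ < θ * B₂ / k ∧ α (m - k) / α m ≤ min (1 / (1 + θ)) (2 * θ / (1 + θ))

/-- A non-steep project exists, `B₁ < θ B₂ / (k + θ²)`, `α_{m-k} ≥ 2 α_{m-k-1}` (if there is a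
project `m-k-1`), `2θ / (1 + θ) ≤ α_{m-k} / α_m ≤ 2 (1 - θ) / (2 - θ)`, and `m - k` is the only
`2`-steep project. -/
def JointCase (θ B₁ B₂ : ℝ) (m k : ℕ) (α : ℕ → ℝ) : Prop :=
  k < m ∧ B₁ < θ * B₂ / (k + θ ^ 2) ∧
    (k + 1 < m → 2 * α (m - k - 1) ≤ α (m - k)) ∧
    2 * θ / (1 + θ) ≤ α (m - k) / α m ∧
    α (m - k) / α m ≤ 2 * (1 - θ) / (2 - θ) ∧
    ∀ ω : Finset.Icc 1 m, (twoPlayerGame θ B₁ B₂ m α).IsTwoSteep ω ↔ (ω : ℕ) = m - k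

end

/-! Since `θ < 1`, the larger contributor to a project always gets a share, so no value is lost and
the welfare is `∑ c ω * (a ω + b ω)`. The optimum spends both budgets on steep projects, and all
depends on how much an equilibrium spends elsewhere.

A player's payoff from a project is piecewise linear in her own contribution: slope `0` below the
lower threshold, `c / 2` while both share, `c` once the opponent is excluded, with upward jumps
between (if the opponent contributes). Best responses are therefore tested against a price `l` per
unit of budget. Maximizing payoff minus price at every project suffices
(`isBestResponse_of_lagrangian`); conversely, profitable reallocations contradict optimality
(`lagrangian_le`, `transfer`).

Close budgets: a unit on a shared steep project earns `M / 2`, at least the coefficient of any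
non-steep project. Neither player can then be alone on a non-steep project, and if both are there,
each must sit at her lower threshold against the other, impossible for `θ < 1`
(`eq_zero_on_nonsteep`). Every equilibrium is thus optimal.

Far budgets: as `∑ a ω / θ < B₂`, the second player has surplus to exclude the first one from any
given project (`raise_le`). She does so on every steep project that gets contributions, so her price
is `M` and the first player retreats to non-steep projects. Either she stays away from these too, or
she joins one with exactly the fraction `θ` of his contribution; then his entire budget is there.
Each alternative fixes the welfare, and her options of leaving, joining and excluding give the
coefficient bounds (`shared_or_separate`). Explicit equilibria of both kinds show that the bounds
are sharp. -/

/-- The share, per unit of the coefficient, of a player who contributes `x` to a project to which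
the other player contributes `y`. -/
noncomputable def equalShare (θ x y : ℝ) : ℝ :=
  if θ * y ≤ x then (if θ * x ≤ y then (x + y) / 2 else x + y) else 0

/-! ### The share as a function of the two contributions. -/

section EqualShare

variable {θ x y : ℝ}

lemma equalShare_of_lt (h : x < θ * y) : equalShare θ x y = 0 := by
  rw [equalShare, if_neg (not_le.2 h)]

lemma equalShare_of_le_of_le (h : θ * y ≤ x) (h' : θ * x ≤ y) :
    equalShare θ x y = (x + y) / 2 := by
  rw [equalShare, if_pos h, if_pos h']

lemma equalShare_of_gt (hθ₀ : 0 < θ) (hθ₁ : θ < 1) (hx : 0 ≤ x) (h : y < θ * x) :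
    equalShare θ x y = x + y := by
  have h1 : θ * y ≤ x := by
    have h2 : 0 ≤ x * (1 - θ) := mul_nonneg hx (sub_nonneg.2 hθ₁.le)
    nlinarith [mul_lt_mul_of_pos_left h hθ₀, mul_nonneg hθ₀.le h2]
  rw [equalShare, if_pos h1, if_neg (not_le.2 h)]

lemma equalShare_zero_right (hθ₀ : 0 < θ) (hθ₁ : θ < 1) (hx : 0 ≤ x) :
    equalShare θ x 0 = x := by
  rcases hx.eq_or_lt with rfl | hx
  · simp [equalShare]
  · rw [equalShare_of_gt hθ₀ hθ₁ hx.le (by positivity), add_zero]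

lemma equalShare_zero_left (hθ₀ : 0 < θ) (hy : 0 ≤ y) : equalShare θ 0 y = 0 := by
  rcases hy.eq_or_lt with rfl | hy
  · simp [equalShare]
  · exact equalShare_of_lt (by positivity)

lemma equalShare_nonneg (hx : 0 ≤ x) (hy : 0 ≤ y) : 0 ≤ equalShare θ x y := by
  unfold equalShare; split_ifs <;> linarith

lemma half_add_le_equalShare (hx : 0 ≤ x) (hy : 0 ≤ y) (h : θ * y ≤ x) :
    (x + y) / 2 ≤ equalShare θ x y := by
  unfold equalShare; split_ifs <;> linarith

lemma equalShare_le_half_add (hx : 0 ≤ x) (hy : 0 ≤ y) (h : θ * x ≤ y) :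
    equalShare θ x y ≤ (x + y) / 2 := by
  unfold equalShare; split_ifs <;> linarith

lemma equalShare_le_add (hx : 0 ≤ x) (hy : 0 ≤ y) : equalShare θ x y ≤ x + y := by
  unfold equalShare; split_ifs <;> linarith

/-- A sharer earns at least half of each extra unit, since crossing the threshold that excludes the
opponent only raises her share. -/
lemma equalShare_add_half_le (hθ₀ : 0 < θ) (hx : 0 ≤ x) (hy : 0 ≤ y) (h : θ * y ≤ x)
    {d : ℝ} (hd : 0 ≤ d) : equalShare θ x y + d / 2 ≤ equalShare θ (x + d) y := by
  have := mul_nonneg hθ₀.le hd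
  unfold equalShare; split_ifs <;> linarith

end EqualShare

/-! ### Consequences of being a best response. -/

section BestResponse

variable {Ω : Type*} [Fintype Ω] {θ B : ℝ} {c x y : Ω → ℝ}

/-- The allocation `x` of a budget `B` is a best response to the allocation `y` of the
other player. -/
structure IsBestResponse (θ : ℝ) (c : Ω → ℝ) (B : ℝ) (x y : Ω → ℝ) : Prop where
  nonneg : ∀ ω, 0 ≤ x ω
  sum_le : ∑ ω, x ω ≤ B
  le : ∀ z : Ω → ℝ, (∀ ω, 0 ≤ z ω) → ∑ ω, z ω ≤ B →
    ∑ ω, c ω * equalShare θ (z ω) (y ω) ≤ ∑ ω, c ω * equalShare θ (x ω) (y ω)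

namespace IsBestResponse

/-- If a reallocation does not lower the Lagrangian at any project but `ω₀`, then it does not
raise it at `ω₀`. -/
lemma lagrangian_le (h : IsBestResponse θ c B x y) (l : ℝ) (z : Ω → ℝ) (hz : ∀ ω, 0 ≤ z ω)
    (hsum : ∑ ω, z ω = ∑ ω, x ω) (ω₀ : Ω)
    (hle : ∀ ω, ω ≠ ω₀ → c ω * equalShare θ (x ω) (y ω) - l * x ω ≤
      c ω * equalShare θ (z ω) (y ω) - l * z ω) :
    c ω₀ * equalShare θ (z ω₀) (y ω₀) - l * z ω₀ ≤
      c ω₀ * equalShare θ (x ω₀) (y ω₀) - l * x ω₀ := by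
  by_contra! hlt
  have h1 := h.le z hz (hsum ▸ h.sum_le)
  have h2 : ∑ ω, (c ω * equalShare θ (x ω) (y ω) - l * x ω) <
      ∑ ω, (c ω * equalShare θ (z ω) (y ω) - l * z ω) := by
    refine Finset.sum_lt_sum (fun ω _ => ?_) ⟨ω₀, Finset.mem_univ _, hlt⟩
    rcases eq_or_ne ω ω₀ with rfl | hne
    exacts [hlt.le, hle ω hne]
  rw [Finset.sum_sub_distrib, Finset.sum_sub_distrib, ← Finset.mul_sum, ← Finset.mul_sum,
    hsum] at h2
  linarith

variable [DecidableEq Ω]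

/-- Moving an amount `d` from one project to another is not profitable. -/
lemma transfer (h : IsBestResponse θ c B x y) {ω ω' : Ω} (hne : ω ≠ ω') {d : ℝ} (hd₀ : 0 ≤ d)
    (hd : d ≤ x ω) :
    c ω * equalShare θ (x ω - d) (y ω) + c ω' * equalShare θ (x ω' + d) (y ω') ≤
      c ω * equalShare θ (x ω) (y ω) + c ω' * equalShare θ (x ω') (y ω') := by
  set z : Ω → ℝ := fun w => x w + ((if w = ω' then d else 0) - if w = ω then d else 0) with hz
  have hzω : z ω = x ω - d := by simp [hz, hne, sub_eq_add_neg]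
  have hzω' : z ω' = x ω' + d := by simp [hz, hne.symm]
  have hz' : ∀ w, w ≠ ω → w ≠ ω' → z w = x w := fun w h1 h2 => by simp [hz, h1, h2]
  have hznn : ∀ w, 0 ≤ z w := by
    intro w
    by_cases h1 : w = ω
    · subst h1; linarith
    by_cases h2 : w = ω'
    · subst h2; linarith [h.nonneg w]
    · rw [hz' w h1 h2]; exact h.nonneg w
  have h1 := h.le z hznn (by simpa [hz, Finset.sum_add_distrib] using h.sum_le)
  rw [← sub_nonneg, ← Finset.sum_sub_distrib, Fintype.sum_eq_add ω ω' hne, hzω, hzω'] at h1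
  · linarith
  · rintro w ⟨h1, h2⟩
    rw [hz' w h1 h2, sub_self]

/-- A player who gets a share of some project gets a share of all projects to which she
contributes, and exhausts her budget. -/
lemma no_waste (h : IsBestResponse θ c B x y) (hθ₀ : 0 < θ) (hc : ∀ ω, 0 < c ω)
    (hy : ∀ ω, 0 ≤ y ω) {ω₀ : Ω} (hω₀ : θ * y ω₀ ≤ x ω₀) :
    ∑ ω, x ω = B ∧ ∀ ω, x ω < θ * y ω → x ω = 0 := by
  constructor
  · by_contra hne
    have hlt := lt_of_le_of_ne h.sum_le hne
    set d := B - ∑ ω, x ω with hd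
    have hdpos : 0 < d := sub_pos.2 hlt
    have h1 := h.le (fun w => x w + if w = ω₀ then d else 0)
      (fun w => add_nonneg (h.nonneg w) (by split_ifs <;> linarith))
      (by simp [Finset.sum_add_distrib, hd])
    rw [← sub_nonneg, ← Finset.sum_sub_distrib, Fintype.sum_eq_single ω₀] at h1
    · have h2 := equalShare_add_half_le hθ₀ (h.nonneg ω₀) (hy ω₀) hω₀ hdpos.le
      simp only [if_true] at h1
      nlinarith [hc ω₀]
    · intro w hw; simp [hw]
  · intro ω hω
    by_contra hne
    have hpos : 0 < x ω := lt_of_le_of_ne (h.nonneg ω) (Ne.symm hne)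
    have hωω₀ : ω ≠ ω₀ := by rintro rfl; linarith
    have h1 := h.transfer hωω₀ hpos.le le_rfl
    rw [sub_self, equalShare_zero_left hθ₀ (hy ω), equalShare_of_lt hω] at h1
    have h2 := equalShare_add_half_le hθ₀ (h.nonneg ω₀) (hy ω₀) hω₀ hpos.le
    nlinarith [hc ω₀]

/-- Staking the whole budget on `ω₀` already earns something. -/
lemma sum_pos_of_single (h : IsBestResponse θ c B x y) (hc : ∀ ω, 0 < c ω)
    (hy : ∀ ω, 0 ≤ y ω) (hB : 0 < B) {ω₀ : Ω} (hω₀ : θ * y ω₀ ≤ B) :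
    0 < ∑ ω, c ω * equalShare θ (x ω) (y ω) := by
  have hnn : ∀ w, 0 ≤ if w = ω₀ then B else 0 := fun w => by split_ifs <;> linarith
  refine lt_of_lt_of_le ?_ (h.le (fun w => if w = ω₀ then B else 0) hnn (by simp))
  refine lt_of_lt_of_le ?_ (Finset.single_le_sum
    (fun w _ => mul_nonneg (hc w).le (equalShare_nonneg (hnn w) (hy w))) (Finset.mem_univ ω₀))
  refine mul_pos (hc _) (lt_of_lt_of_le ?_
    (half_add_le_equalShare (hnn _) (hy _) (by simpa using hω₀)))
  rw [if_pos rfl]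
  linarith [hy ω₀]

lemma exists_sharer (h : IsBestResponse θ c B x y) (hc : ∀ ω, 0 < c ω)
    (hy : ∀ ω, 0 ≤ y ω) (hB : 0 < B) {ω₀ : Ω} (hω₀ : θ * y ω₀ ≤ B) :
    ∃ ω, θ * y ω ≤ x ω := by
  by_contra! hlt
  have h1 := h.sum_pos_of_single hc hy hB hω₀
  rw [Finset.sum_eq_zero fun ω _ => by rw [equalShare_of_lt (hlt ω), mul_zero]] at h1
  exact lt_irrefl _ h1

/-- A player whose budget is at least the fraction `θ` of the other one's wastes nothing. -/
lemma no_waste_of_le [Nonempty Ω] {C : ℝ} (h : IsBestResponse θ c B x y) (hθ₀ : 0 < θ)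
    (hc : ∀ ω, 0 < c ω) (hy : ∀ ω, 0 ≤ y ω) (hyC : ∑ ω, y ω ≤ C) (hB : 0 < B)
    (hCB : θ * C ≤ B) :
    ∑ ω, x ω = B ∧ ∀ ω, x ω < θ * y ω → x ω = 0 := by
  obtain ⟨ω₀⟩ := ‹Nonempty Ω›
  have h1 : y ω₀ ≤ C :=
    (Finset.single_le_sum (fun w _ => hy w) (Finset.mem_univ ω₀)).trans hyC
  obtain ⟨ω, hω⟩ := h.exists_sharer hc hy hB (ω₀ := ω₀)
    ((mul_le_mul_of_nonneg_left h1 hθ₀.le).trans hCB)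
  exact h.no_waste hθ₀ hc hy hω

end IsBestResponse

end BestResponse

/-! ### Close budgets: equilibria use steep projects only. -/

section CloseBudgets

variable {Ω : Type*} [Fintype Ω] {θ B C M : ℝ} {c x y : Ω → ℝ}

namespace IsBestResponse

variable [DecidableEq Ω]

/-- If the opponent contributes to every steep project, then the player gets a share of every
steep project, and contributes just enough to get a share of the non-steep ones. -/
lemma of_opponent_on_steep (h : IsBestResponse θ c B x y) (hθ₀ : 0 < θ)
    (hc : ∀ ω, 0 < c ω) (hcM : ∀ ω, c ω = M ∨ 2 * c ω ≤ M) {ω₀ : Ω} (hω₀ : c ω₀ = M)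
    (hy : ∀ ω, 0 ≤ y ω) (hyC : ∑ ω, y ω ≤ C) (hCB : θ * C ≤ B) (hxB : ∑ ω, x ω = B)
    (hxw : ∀ ω, x ω < θ * y ω → x ω = 0) (hyw : ∀ ω, y ω < θ * x ω → y ω = 0)
    (hfree : ∀ ω, c ω = M → 0 < y ω) (ω : Ω) :
    (c ω = M → θ * y ω ≤ x ω) ∧ (2 * c ω ≤ M → 0 < y ω → 0 < x ω → x ω ≤ θ * y ω) ∧
      (2 * c ω ≤ M → 0 < y ω → x ω = 0 → c ω * (1 + θ) ≤ M * θ) := by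
  classical
  have hM : 0 < M := hω₀ ▸ hc ω₀
  -- The competing allocation pays only the entry fee `θ * y w`, and not even that where joining a
  -- non-steep project is not worth the price `M / 2`. The rest goes to the steep project `ω₀`.
  set base : Ω → ℝ := fun w =>
    if c w ≠ M ∧ x w = 0 ∧ c w * (1 + θ) ≤ M * θ then 0 else θ * y w with hbase
  have hθy : ∀ w, 0 ≤ θ * y w := fun w => mul_nonneg hθ₀.le (hy w)
  have hbase₀ : ∀ w, 0 ≤ base w := fun w => by
    simp only [hbase]; split_ifs; exacts [le_rfl, hθy w]
  have hbase₁ : ∑ w, base w ≤ B := by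
    calc ∑ w, base w ≤ ∑ w, θ * y w := Finset.sum_le_sum fun w _ => by
          simp only [hbase]; split_ifs; exacts [hθy w, le_rfl]
      _ = θ * ∑ w, y w := by rw [Finset.mul_sum]
      _ ≤ θ * C := mul_le_mul_of_nonneg_left hyC hθ₀.le
      _ ≤ B := hCB
  set z : Ω → ℝ := fun w => base w + if w = ω₀ then B - ∑ w, base w else 0 with hz
  have hz₀ : ∀ w, 0 ≤ z w := fun w =>
    add_nonneg (hbase₀ w) (by split_ifs <;> linarith)
  have hzsum : ∑ w, z w = ∑ w, x w := by
    simp [hz, Finset.sum_add_distrib, hxB]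
  have hsteep : ∀ w, c w = M → M / 2 * y w ≤ c w * equalShare θ (z w) (y w) - M / 2 * z w := by
    intro w hw
    have h1 : θ * y w ≤ z w := by
      simp only [hz, hbase, hw]
      simp only [ne_eq, not_true_eq_false, false_and, if_false]
      split_ifs with h2
      · linarith
      · simp
    have h2 := half_add_le_equalShare (hz₀ w) (hy w) h1
    rw [hw]
    nlinarith
  have hns : ∀ w, 2 * c w ≤ M → c w ≠ M := fun w hw h1 => by linarith
  have hzns : ∀ w, 2 * c w ≤ M → z w = base w := by
    intro w hw
    have : w ≠ ω₀ := by rintro rfl; linarith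
    simp [hz, this]
  have hshare : ∀ w, 0 < y w → 0 < x w → θ * y w ≤ x w ∧
      equalShare θ (x w) (y w) = (x w + y w) / 2 := by
    intro w hyp hxp
    have h1 : θ * y w ≤ x w := by
      by_contra! h1; exact hxp.ne' (hxw w h1)
    exact ⟨h1, equalShare_of_le_of_le h1 (by by_contra! h2; exact hyp.ne' (hyw w h2))⟩
  have hzshare : ∀ w, 0 ≤ y w → (θ * y w + y w) / 2 ≤ equalShare θ (θ * y w) (y w) :=
    fun w hw => half_add_le_equalShare (hθy w) hw le_rfl
  have hle : ∀ w, c w * equalShare θ (x w) (y w) - M / 2 * x w ≤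
      c w * equalShare θ (z w) (y w) - M / 2 * z w := by
    intro w
    rcases hcM w with hw | hw
    · refine le_trans ?_ (hsteep w hw)
      rcases (h.nonneg w).eq_or_lt with hx0 | hx0
      · rw [← hx0, equalShare_zero_left hθ₀ (hy w)]
        nlinarith [hfree w hw]
      · rw [(hshare w (hfree w hw) hx0).2, hw]
        linarith
    · rw [hzns w hw]
      rcases (hy w).eq_or_lt with hy0 | hy0
      · have h1 : base w = 0 := by simp [hbase, ← hy0]
        rw [h1, ← hy0, equalShare_zero_left hθ₀ le_rfl]
        have h2 := equalShare_le_add (θ := θ) (h.nonneg w) le_rfl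
        nlinarith [hc w, h.nonneg w]
      rcases (h.nonneg w).eq_or_lt with hx0 | hx0
      · rw [← hx0, equalShare_zero_left hθ₀ (hy w)]
        by_cases h1 : c w * (1 + θ) ≤ M * θ
        · have h2 : base w = 0 := by simp [hbase, ← hx0, h1, hns w hw]
          rw [h2, equalShare_zero_left hθ₀ (hy w)]
        · have h2 : base w = θ * y w := by simp [hbase, h1]
          rw [h2]
          have h3 := hzshare w hy0.le
          nlinarith [hc w]
      · have h2 : base w = θ * y w := by simp [hbase, hx0.ne']
        rw [h2, (hshare w hy0 hx0).2]
        have h3 := hzshare w hy0.le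
        nlinarith [hc w, (hshare w hy0 hx0).1]
  -- At price `M / 2` the competitor is at least as good everywhere, so optimality forces equality
  -- at `ω`; the failure of any of the three claims would make it strictly better there.
  have hge := h.lagrangian_le (M / 2) z hz₀ hzsum ω fun w _ => hle w
  refine ⟨fun hw => ?_, fun hw hyp hxp => ?_, fun hw hyp hx0 => ?_⟩
  · by_contra! h1
    rw [hxw ω h1, equalShare_zero_left hθ₀ (hy ω)] at hge
    nlinarith [hsteep ω hw, hfree ω hw]
  · have h2 : base ω = θ * y ω := by simp [hbase, hxp.ne']
    rw [hzns ω hw, h2, (hshare ω hyp hxp).2] at hge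
    have h3 := hzshare ω hyp.le
    nlinarith [hc ω]
  · by_contra! h1
    have h2 : base ω = θ * y ω := by simp [hbase, h1]
    rw [hx0, equalShare_zero_left hθ₀ (hy ω), hzns ω hw, h2] at hge
    have h3 := hzshare ω hyp.le
    nlinarith [hc ω]

/-- A lone contributor would move to a steep project free of the opponent, so the opponent is on all
of them, and then both share all of them. Her not moving to a steep one gives `M ≤ 2 * c ω`; the
opponent's not joining her gives `c ω * (1 + θ) ≤ M * θ`. These clash for `θ < 1`. -/
lemma not_alone_on_nonsteep (h : IsBestResponse θ c B x y) (h' : IsBestResponse θ c C y x)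
    (hθ₀ : 0 < θ) (hθ₁ : θ < 1)
    (hc : ∀ ω, 0 < c ω) (hcM : ∀ ω, c ω = M ∨ 2 * c ω ≤ M) {ω₀ : Ω} (hω₀ : c ω₀ = M)
    (hCB : θ * C ≤ B) (hBC : θ * B ≤ C) (hxB : ∑ ω, x ω = B) (hyC : ∑ ω, y ω = C)
    (hxw : ∀ ω, x ω < θ * y ω → x ω = 0) (hyw : ∀ ω, y ω < θ * x ω → y ω = 0)
    {ω : Ω} (hω : 2 * c ω ≤ M) (hyω : 0 < y ω) : x ω ≠ 0 := by
  intro hxω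
  have hM : 0 < M := hω₀ ▸ hc ω₀
  have hne : ∀ w, c w = M → ω ≠ w := by rintro w hw rfl; linarith
  have hlose : equalShare θ (y ω) (x ω) = y ω := by
    rw [hxω, equalShare_zero_right hθ₀ hθ₁ (h'.nonneg ω)]
  have hxpos : ∀ w, c w = M → 0 < x w := by
    intro w hw
    by_contra! hxw0
    have hxw0 := le_antisymm hxw0 (h.nonneg w)
    have h1 := h'.transfer (hne w hw) hyω.le le_rfl
    rw [sub_self, equalShare_zero_left hθ₀ (h.nonneg ω), hlose, hxw0,
      equalShare_zero_right hθ₀ hθ₁ (h'.nonneg w),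
      equalShare_zero_right hθ₀ hθ₁ (add_nonneg (h'.nonneg w) hyω.le), hw] at h1
    nlinarith
  have hy := h'.of_opponent_on_steep hθ₀ hc hcM hω₀ h.nonneg hxB.le hBC hyC hyw hxw hxpos
  have hypos : ∀ w, c w = M → 0 < y w := fun w hw =>
    lt_of_lt_of_le (mul_pos hθ₀ (hxpos w hw)) ((hy w).1 hw)
  have h1 := (h.of_opponent_on_steep hθ₀ hc hcM hω₀ h'.nonneg hyC.le hCB hxB hxw hyw
    hypos ω).2.2 hω hyω hxω
  have h2 := h'.transfer (hne ω₀ hω₀) hyω.le le_rfl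
  rw [sub_self, equalShare_zero_left hθ₀ (h.nonneg ω), hlose, hω₀] at h2
  have h3 := equalShare_add_half_le hθ₀ (h'.nonneg ω₀) (h.nonneg ω₀) ((hy ω₀).1 hω₀) hyω.le
  have h4 : M ≤ 2 * c ω := by
    by_contra! h4
    nlinarith
  nlinarith

/-- The excess over `θ * y ω` earns only `c ω / 2` per unit. It would earn `M` on a steep project
without the opponent; if there is none, `of_opponent_on_steep` applies. -/
lemma not_flexible_on_nonsteep (h : IsBestResponse θ c B x y) (h' : IsBestResponse θ c C y x)
    (hθ₀ : 0 < θ) (hθ₁ : θ < 1)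
    (hc : ∀ ω, 0 < c ω) (hcM : ∀ ω, c ω = M ∨ 2 * c ω ≤ M) {ω₀ : Ω} (hω₀ : c ω₀ = M)
    (hCB : θ * C ≤ B) (hxB : ∑ ω, x ω = B) (hyC : ∑ ω, y ω = C)
    (hxw : ∀ ω, x ω < θ * y ω → x ω = 0) (hyw : ∀ ω, y ω < θ * x ω → y ω = 0)
    {ω : Ω} (hω : 2 * c ω ≤ M) (hyω : 0 < y ω) (hxω : 0 < x ω) : x ω ≤ θ * y ω := by
  have hM : 0 < M := hω₀ ▸ hc ω₀
  by_contra! hlt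
  by_cases hfree : ∀ w, c w = M → 0 < y w
  · exact absurd ((h.of_opponent_on_steep hθ₀ hc hcM hω₀ h'.nonneg hyC.le hCB hxB hxw hyw
      hfree ω).2.1 hω hyω hxω) (not_le.2 hlt)
  push Not at hfree
  obtain ⟨w, hw, hyw0⟩ := hfree
  have hyw0 := le_antisymm hyw0 (h'.nonneg w)
  have hne : ω ≠ w := by rintro rfl; linarith
  have hθy : 0 ≤ θ * y ω := by positivity
  have h1 := h.transfer hne (sub_nonneg.2 hlt.le) (by linarith)
  rw [sub_sub_cancel, hyw0, equalShare_zero_right hθ₀ hθ₁ (h.nonneg w),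
    equalShare_zero_right hθ₀ hθ₁ (add_nonneg (h.nonneg w) (sub_nonneg.2 hlt.le)), hw] at h1
  have h2 := half_add_le_equalShare hθy hyω.le (le_refl (θ * y ω))
  have h3 := equalShare_le_half_add hxω.le hyω.le
    (by by_contra! h2; exact hyω.ne' (hyw ω h2))
  nlinarith [hc ω]

/-- With close budgets, nobody contributes to a non-steep project in an equilibrium. -/
lemma eq_zero_on_nonsteep (h : IsBestResponse θ c B x y) (h' : IsBestResponse θ c C y x)
    (hθ₀ : 0 < θ) (hθ₁ : θ < 1)
    (hc : ∀ ω, 0 < c ω) (hcM : ∀ ω, c ω = M ∨ 2 * c ω ≤ M) {ω₀ : Ω} (hω₀ : c ω₀ = M)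
    (hCB : θ * C ≤ B) (hBC : θ * B ≤ C) (hxB : ∑ ω, x ω = B) (hyC : ∑ ω, y ω = C)
    (hxw : ∀ ω, x ω < θ * y ω → x ω = 0) (hyw : ∀ ω, y ω < θ * x ω → y ω = 0)
    {ω : Ω} (hω : 2 * c ω ≤ M) : y ω = 0 := by
  by_contra hne
  have hyω := lt_of_le_of_ne (h'.nonneg ω) (Ne.symm hne)
  have hxω := lt_of_le_of_ne (h.nonneg ω) (Ne.symm
    (h.not_alone_on_nonsteep h' hθ₀ hθ₁ hc hcM hω₀ hCB hBC hxB hyC hxw hyw hω hyω))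
  have h1 := h.not_flexible_on_nonsteep h' hθ₀ hθ₁ hc hcM hω₀ hCB hxB hyC hxw hyw hω hyω hxω
  have h2 := h'.not_flexible_on_nonsteep h hθ₀ hθ₁ hc hcM hω₀ hBC hyC hxB hyw hxw hω hxω hyω
  nlinarith

end IsBestResponse

/-- Splitting the budget evenly over the steep projects is a best response to the opponent's
doing the same. -/
lemma isBestResponse_even_even (hθ₀ : 0 < θ) (hc : ∀ ω, 0 < c ω)
    (hcM : ∀ ω, c ω = M ∨ 2 * c ω ≤ M) {k : ℕ} (hk : 1 ≤ k)
    (hcard : (Finset.univ.filter fun ω => c ω = M).card = k)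
    (hB : 0 ≤ B) (hC : 0 ≤ C) (hCB : θ * C ≤ B) (hBC : k * θ * B ≤ C) :
    IsBestResponse θ c B (fun ω => if c ω = M then B / k else 0)
      (fun ω => if c ω = M then C / k else 0) := by
  have hk0 : (0 : ℝ) < k := by exact_mod_cast hk
  have hsum : ∀ D : ℝ, ∑ ω, (if c ω = M then D / k else 0) = D := by
    intro D
    rw [← Finset.sum_filter, Finset.sum_const, hcard, nsmul_eq_mul]
    field_simp
  have hk1 : (1 : ℝ) ≤ k := by exact_mod_cast hk
  have hθBC : θ * B ≤ C := by nlinarith [mul_nonneg hθ₀.le hB]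
  have hM : 0 < M := by
    obtain ⟨ω, hω⟩ := Finset.card_pos.1 (hcard ▸ hk : 0 < (Finset.univ.filter fun ω => c ω = M).card)
    exact (Finset.mem_filter.1 hω).2 ▸ hc ω
  refine ⟨fun ω => by split_ifs <;> positivity, (hsum B).le, fun z hz hzB => ?_⟩
  -- By `k * θ * B ≤ C` even the whole budget on one steep project cannot exclude the opponent, so a
  -- unit earns at most `M / 2` anywhere. The even split attains this bound.
  have hup : ∀ ω, c ω * equalShare θ (z ω) (if c ω = M then C / k else 0) ≤
      M / 2 * z ω + M / 2 * (if c ω = M then C / k else 0) := by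
    intro ω
    have hzω : z ω ≤ B := (Finset.single_le_sum (fun w _ => hz w) (Finset.mem_univ ω)).trans hzB
    rcases hcM ω with hω | hω
    · simp only [hω, if_true]
      have h1 : θ * z ω ≤ C / k := by
        rw [le_div_iff₀ hk0]
        nlinarith [mul_le_mul_of_nonneg_left hzω (mul_pos hk0 hθ₀).le]
      have := equalShare_le_half_add (hz ω) (by positivity) h1
      nlinarith
    · have h1 : c ω ≠ M := by intro h1; linarith
      simp only [h1, if_false]
      have := equalShare_le_add (θ := θ) (hz ω) le_rfl
      nlinarith [hc ω, hz ω]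
  have hlow : ∀ ω, M / 2 * (if c ω = M then B / k else 0) +
      M / 2 * (if c ω = M then C / k else 0) ≤
      c ω * equalShare θ (if c ω = M then B / k else 0) (if c ω = M then C / k else 0) := by
    intro ω
    split_ifs with hω
    · have := half_add_le_equalShare (θ := θ) (x := B / k) (y := C / k) (by positivity)
        (by positivity) (by rw [← mul_div_assoc]; gcongr)
      rw [hω]
      nlinarith
    · simp [equalShare]
  refine (Finset.sum_le_sum fun ω _ => hup ω).trans
    (le_trans ?_ (Finset.sum_le_sum fun ω _ => hlow ω))
  simp only [Finset.sum_add_distrib, ← Finset.mul_sum, hsum]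
  nlinarith

end CloseBudgets

/-! ### Far budgets: structure of the equilibria. -/

section FarBudgets

variable {Ω : Type*} [Fintype Ω] {θ B₁ B₂ M : ℝ} {c a b : Ω → ℝ}

/-- An equilibrium of a game with a steep and a non-steep project, in which the first budget is
smaller than the fraction `θ` of the second one. -/
structure FarEquilibrium (θ B₁ B₂ M : ℝ) (c a b : Ω → ℝ) : Prop where
  pos : 0 < θ
  lt_one : θ < 1
  budget_pos : 0 < B₁
  far : B₁ < θ * B₂
  coeff_pos : ∀ ω, 0 < c ω
  coeff_le : ∀ ω, c ω ≤ M
  exists_steep : ∃ ω, c ω = M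
  exists_nonsteep : ∃ ω, c ω < M
  left : IsBestResponse θ c B₁ a b
  right : IsBestResponse θ c B₂ b a

namespace FarEquilibrium

variable [DecidableEq Ω]

lemma right_no_waste (h : FarEquilibrium θ B₁ B₂ M c a b) :
    ∑ ω, b ω = B₂ ∧ ∀ ω, b ω < θ * a ω → b ω = 0 := by
  have : Nonempty Ω := ⟨h.exists_steep.choose⟩
  have h1 := h.pos
  have h2 := h.lt_one
  have h3 := h.budget_pos
  have h4 := h.far
  have hB₂ : 0 < B₂ := by
    by_contra! h5
    nlinarith
  exact h.right.no_waste_of_le h1 h.coeff_pos h.left.nonneg h.left.sum_le hB₂ (by nlinarith)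

/-- The second player does not gain by raising her contribution to a project so far that the first
player gets nothing from it. -/
lemma raise_le (h : FarEquilibrium θ B₁ B₂ M c a b) {ω₀ : Ω} (hω₀ : θ * b ω₀ ≤ a ω₀) :
    c ω₀ * (a ω₀ / θ + a ω₀) - M * (a ω₀ / θ) ≤
      c ω₀ * equalShare θ (b ω₀) (a ω₀) - M * b ω₀ := by
  have hθ := h.pos
  have hθ₁ := h.lt_one
  have ha := h.left.nonneg
  have hb := h.right.nonneg
  have haθ : ∀ w, 0 ≤ a w / θ := fun w => div_nonneg (ha w) hθ.le
  set gap := a ω₀ / θ - b ω₀ with hgap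
  have hgap₀ : 0 ≤ gap := by
    rw [hgap, sub_nonneg, le_div_iff₀ hθ]; linarith
  -- `g` is the surplus on the other projects beyond the level `a w / θ` that keeps the first player
  -- out, and `gap` is what is missing to that level at `ω₀`. Total surplus suffices because `∑ a w
  -- / θ < B₂`.
  set g : Ω → ℝ := fun w => if w = ω₀ then 0 else max (b w - a w / θ) 0 with hg
  have hg₀ : ∀ w, 0 ≤ g w := fun w => by
    simp only [hg]; split_ifs; exacts [le_rfl, le_max_right _ _]
  have hgb : ∀ w, g w ≤ b w := fun w => by
    simp only [hg]; split_ifs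
    exacts [hb w, max_le (by linarith [haθ w]) (hb w)]
  set S := ∑ w, g w with hS
  have hgapS : gap < S := by
    have h1 : ∑ w, (b w - a w / θ) ≤ ∑ w, (g w + if w = ω₀ then -gap else 0) := by
      refine Finset.sum_le_sum fun w _ => ?_
      simp only [hg]
      split_ifs with hw
      · rw [hw, hgap]; linarith
      · simp
    simp only [Finset.sum_sub_distrib, Finset.sum_add_distrib, Finset.sum_ite_eq',
      Finset.mem_univ, if_true, ← Finset.sum_div, h.right_no_waste.1] at h1
    have h2 : (∑ w, a w) / θ < B₂ := by
      rw [div_lt_iff₀ hθ]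
      linarith [h.left.sum_le, h.far]
    linarith
  have key : ∀ e, 0 < e → e < S - gap →
      c ω₀ * (a ω₀ / θ + e + a ω₀) - M * (a ω₀ / θ + e) ≤
        c ω₀ * equalShare θ (b ω₀) (a ω₀) - M * b ω₀ := by
    intro e he heS
    have hSpos : 0 < S := by linarith
    -- Shrinking every surplus by the same factor `t < 1` keeps the first player excluded wherever
    -- he was, so each unit taken away costs at most `M`.
    set t := (gap + e) / S with ht
    have ht₀ : 0 ≤ t := div_nonneg (by linarith) hSpos.le
    have ht₁ : t < 1 := by rw [ht, div_lt_one hSpos]; linarith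
    have htS : t * S = gap + e := by rw [ht]; field_simp
    set z : Ω → ℝ := fun w => b w - t * g w + if w = ω₀ then gap + e else 0 with hz
    have hz₀ : ∀ w, 0 ≤ z w := fun w => by
      refine add_nonneg ?_ (by split_ifs <;> linarith)
      nlinarith [hg₀ w, hgb w]
    have hzω₀ : z ω₀ = a ω₀ / θ + e := by
      simp only [hz, hg, if_true, hgap]; ring
    have h1 := h.right.lagrangian_le M z hz₀
      (by simp [hz, Finset.sum_add_distrib, ← Finset.mul_sum, ← hS, htS]) ω₀ (fun w hw => ?_)
    · rw [hzω₀, equalShare_of_gt hθ hθ₁ (hzω₀ ▸ hz₀ ω₀)] at h1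
      · exact h1
      · rw [mul_add, mul_div_cancel₀ _ hθ.ne']
        nlinarith
    · rcases le_or_gt (b w) (a w / θ) with hw1 | hw1
      · have : z w = b w := by
          simp [hz, hg, hw, max_eq_right (sub_nonpos.2 hw1)]
        rw [this]
      · have hzw : z w = b w - t * (b w - a w / θ) := by
          simp [hz, hg, hw, max_eq_left (sub_pos.2 hw1).le]
        have h2 : a w / θ < z w := by rw [hzw]; nlinarith
        have h3 : z w ≤ b w := by rw [hzw]; nlinarith
        rw [div_lt_iff₀ hθ] at h2 hw1
        rw [equalShare_of_gt hθ hθ₁ (hz₀ w) (by linarith),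
          equalShare_of_gt hθ hθ₁ (hb w) (by linarith)]
        nlinarith [h.coeff_le w]
  -- Exclusion needs a contribution strictly above `a ω₀ / θ`, hence the limit `e → 0`.
  refine le_of_forall_pos_le_add fun e he => ?_
  have hM := sub_nonneg.2 (h.coeff_le ω₀)
  set d := min ((S - gap) / 2) (e / (M - c ω₀ + 1)) with hd
  have hd₀ : 0 < d := lt_min (by linarith) (by positivity)
  have hd₁ : d ≤ (S - gap) / 2 := min_le_left _ _
  have hd₂ : d * (M - c ω₀ + 1) ≤ e := by
    rw [← le_div_iff₀ (by positivity)]; exact min_le_right _ _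
  have := key d hd₀ (by linarith)
  nlinarith

/-- If the first player had a share, `raise_le` with `c ω = M` would give `M * a ω ≤ M * (a ω - b ω)
/ 2`, so both contributions vanish. -/
lemma steep_dominated (h : FarEquilibrium θ B₁ B₂ M c a b) {ω : Ω} (hω : c ω = M) :
    (a ω = 0 ∧ b ω = 0) ∨ a ω < θ * b ω := by
  by_contra! hcon
  have h1 := h.raise_le hcon.2
  have ha := h.left.nonneg ω
  have hb := h.right.nonneg ω
  have hM : 0 < M := hω ▸ h.coeff_pos ω
  have h2 := equalShare_le_half_add hb ha hcon.2
  rw [hω] at h1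
  have h3 : a ω + b ω ≤ 0 := by
    by_contra! h3
    nlinarith
  exact hcon.1 (by linarith) (by linarith)

/-- This makes `M` the second player's price: every further unit on a steep project pays in full. -/
lemma share_steep_add (h : FarEquilibrium θ B₁ B₂ M c a b) {ω : Ω} (hω : c ω = M) {d : ℝ}
    (hd : 0 ≤ d) : equalShare θ (b ω + d) (a ω) = equalShare θ (b ω) (a ω) + d := by
  rcases h.steep_dominated hω with ⟨ha, hb⟩ | hlt
  · rw [ha, hb, zero_add, equalShare_zero_right h.pos h.lt_one hd,
      equalShare_zero_right h.pos h.lt_one le_rfl, zero_add]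
  · rw [equalShare_of_gt h.pos h.lt_one (h.right.nonneg ω) hlt,
      equalShare_of_gt h.pos h.lt_one (add_nonneg (h.right.nonneg ω) hd)
        (by nlinarith [h.pos])]
    ring

/-- The second player does not gain by moving contributions to a steep project. -/
lemma lower_le (h : FarEquilibrium θ B₁ B₂ M c a b) {ω : Ω} (hω : c ω < M) {t : ℝ}
    (ht₀ : 0 ≤ t) (ht : t ≤ b ω) :
    c ω * equalShare θ t (a ω) - M * t ≤ c ω * equalShare θ (b ω) (a ω) - M * b ω := by
  obtain ⟨w, hw⟩ := h.exists_steep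
  have hne : ω ≠ w := by rintro rfl; linarith
  have h1 := h.right.transfer hne (sub_nonneg.2 ht) (by linarith)
  rw [sub_sub_cancel, h.share_steep_add hw (sub_nonneg.2 ht), hw] at h1
  linarith

/-- The first player can enter a non-steep project: were `θ * b ω > B₁` there, the second player
could cut `b ω`, still exclude him, and move the difference to a steep project. -/
lemma left_no_waste (h : FarEquilibrium θ B₁ B₂ M c a b) :
    ∑ ω, a ω = B₁ ∧ ∀ ω, a ω < θ * b ω → a ω = 0 := by
  suffices hs : ∃ ω, θ * b ω ≤ a ω by
    obtain ⟨ω, hω⟩ := hs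
    exact h.left.no_waste h.pos h.coeff_pos h.right.nonneg hω
  obtain ⟨ω, hω⟩ := h.exists_nonsteep
  rcases le_or_gt (θ * b ω) B₁ with h1 | h1
  · exact h.left.exists_sharer h.coeff_pos h.right.nonneg h.budget_pos h1
  · exfalso
    have hθ := h.pos
    have haB : a ω ≤ B₁ := (Finset.single_le_sum (fun w _ => h.left.nonneg w)
      (Finset.mem_univ ω)).trans h.left.sum_le
    have hlt : B₁ / θ < b ω := by rw [div_lt_iff₀ hθ]; linarith
    have hB : 0 < B₁ / θ := div_pos h.budget_pos hθ
    have hmul : θ * (B₁ / θ) = B₁ := mul_div_cancel₀ _ hθ.ne'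
    have h2 := h.lower_le hω (t := (b ω + B₁ / θ) / 2) (by linarith) (by linarith)
    rw [equalShare_of_gt hθ h.lt_one (by linarith) (by nlinarith),
      equalShare_of_gt hθ h.lt_one (h.right.nonneg ω) (by linarith)] at h2
    nlinarith

lemma left_steep (h : FarEquilibrium θ B₁ B₂ M c a b) {ω : Ω} (hω : c ω = M) : a ω = 0 := by
  rcases h.steep_dominated hω with h1 | h1
  exacts [h1.1, h.left_no_waste.2 ω h1]

/-- A non-steep project to which the second player contributes is shared, and she contributes
just enough to get a share. -/
lemma shared_nonsteep (h : FarEquilibrium θ B₁ B₂ M c a b) {ω : Ω} (hω : c ω < M)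
    (hb : 0 < b ω) :
    0 < a ω ∧ b ω = θ * a ω ∧ 2 * θ * M ≤ c ω * (1 + θ) ∧
      c ω * (2 - θ) ≤ 2 * (1 - θ) * M := by
  have hθ := h.pos
  have hθ₁ := h.lt_one
  have hc := h.coeff_pos ω
  have h1 : θ * b ω ≤ a ω := by
    by_contra! h1
    have h2 := h.lower_le hω le_rfl hb.le
    rw [h.left_no_waste.2 ω h1, equalShare_zero_right hθ hθ₁ le_rfl,
      equalShare_zero_right hθ hθ₁ hb.le] at h2
    nlinarith
  have ha : 0 < a ω := lt_of_lt_of_le (by positivity) h1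
  have h2 : θ * a ω ≤ b ω := by
    by_contra! h2
    exact hb.ne' (h.right_no_waste.2 ω h2)
  have hθa : θ * (θ * a ω) ≤ a ω := by nlinarith
  have h3 := h.lower_le hω (t := θ * a ω) (by positivity) h2
  rw [equalShare_of_le_of_le le_rfl hθa, equalShare_of_le_of_le h2 h1] at h3
  have h4 : b ω = θ * a ω := by
    by_contra h4
    have : θ * a ω < b ω := lt_of_le_of_ne h2 (Ne.symm h4)
    nlinarith
  have h5 := h.lower_le hω le_rfl hb.le
  have h6 := h.raise_le h1
  rw [equalShare_zero_left hθ ha.le, equalShare_of_le_of_le h2 h1, h4] at h5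
  rw [equalShare_of_le_of_le h2 h1, h4] at h6
  refine ⟨ha, h4, ?_, ?_⟩
  · refine le_of_mul_le_mul_right ?_ ha
    nlinarith
  -- In terms of `q = a ω / θ` the inequality `h6` is homogeneous, and the factor `1 + θ` cancels.
  · have h7 : a ω = θ * (a ω / θ) := (mul_div_cancel₀ _ hθ.ne').symm
    set q := a ω / θ with hq
    have hqpos : 0 < q := div_pos ha hθ
    rw [h7] at h6
    have h8 : (1 + θ) * (c ω * (2 - θ)) ≤ (1 + θ) * (2 * (1 - θ) * M) := by
      refine le_of_mul_le_mul_right ?_ hqpos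
      nlinarith
    exact le_of_mul_le_mul_left h8 (by linarith)

/-- If the second player contributes to a non-steep project, then no other non-steep project
gets contributions, and the others are worth at most half of it. -/
lemma other_nonsteep (h : FarEquilibrium θ B₁ B₂ M c a b) {ω ω' : Ω} (hω : c ω < M)
    (hb : 0 < b ω) (hω' : c ω' < M) (hne : ω' ≠ ω) :
    a ω' = 0 ∧ b ω' = 0 ∧ 2 * c ω' ≤ c ω := by
  have hθ := h.pos
  have hθ₁ := h.lt_one
  have hc := h.coeff_pos ω
  have hc' := h.coeff_pos ω'
  have ha' := h.left.nonneg ω'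
  obtain ⟨ha, hbθ, -, -⟩ := h.shared_nonsteep hω hb
  have hflex : 0 < (1 - θ ^ 2) * a ω := mul_pos (by nlinarith) ha
  have hold : equalShare θ (a ω) (b ω) = (a ω + b ω) / 2 :=
    equalShare_of_le_of_le (by rw [hbθ]; nlinarith) hbθ.ge
  -- The first player stays a sharer of `ω` down to `θ * b ω = θ ^ 2 * a ω`, so up to `(1 - θ ^ 2) *
  -- a ω` can leave at a loss of only `c ω / 2` per unit.
  have hmove : ∀ d, 0 < d → d ≤ (1 - θ ^ 2) * a ω →
      c ω' * equalShare θ (a ω' + d) (b ω') ≤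
        c ω * (d / 2) + c ω' * equalShare θ (a ω') (b ω') := by
    intro d hd hda
    have h1 := h.left.transfer hne.symm hd.le (by nlinarith)
    rw [hold, equalShare_of_le_of_le (x := a ω - d) (by rw [hbθ]; nlinarith)
      (by rw [hbθ]; nlinarith)] at h1
    linarith
  have hb' : b ω' = 0 := by
    by_contra hb0
    have hb'pos := lt_of_le_of_ne (h.right.nonneg ω') (Ne.symm hb0)
    obtain ⟨ha'pos, hbθ', -, -⟩ := h.shared_nonsteep hω' hb'pos
    -- At `ω'` the second player is also at her threshold, so any `d > 0` excludes her and yields a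
    -- jump; this `d` is small enough for the jump to outweigh the loss.
    set d := min ((1 - θ ^ 2) * a ω) (c ω' * a ω' / (2 * c ω)) with hd
    have hd₀ : 0 < d := lt_min hflex (by positivity)
    have hd₂ : d * (2 * c ω) ≤ c ω' * a ω' := by
      rw [← le_div_iff₀ (by positivity)]; exact min_le_right _ _
    have h1 := hmove d hd₀ (min_le_left _ _)
    rw [equalShare_of_gt hθ hθ₁ (by linarith) (by rw [hbθ']; nlinarith),
      equalShare_of_le_of_le (by rw [hbθ']; nlinarith) hbθ'.ge] at h1
    nlinarith [mul_pos hc' hd₀, mul_pos hc' hb'pos]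
  have hhalf : 2 * c ω' ≤ c ω := by
    have h1 := hmove _ hflex le_rfl
    rw [hb', equalShare_zero_right hθ hθ₁ ha',
      equalShare_zero_right hθ hθ₁ (add_nonneg ha' hflex.le)] at h1
    by_contra! h2
    nlinarith
  refine ⟨?_, hb', hhalf⟩
  by_contra ha0
  have ha'pos := lt_of_le_of_ne ha' (Ne.symm ha0)
  -- Moving all of `a ω'` to `ω` would exclude the second player there.
  have h1 := h.left.transfer hne ha'pos.le le_rfl
  rw [sub_self, hb', equalShare_zero_left hθ le_rfl, equalShare_zero_right hθ hθ₁ ha', hold,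
    equalShare_of_gt hθ hθ₁ (by linarith) (by rw [hbθ]; nlinarith)] at h1
  nlinarith [mul_pos hc ha'pos, mul_pos hc' ha'pos, mul_pos hc ha, mul_pos hc hb]

lemma left_eq_budget (h : FarEquilibrium θ B₁ B₂ M c a b) {ω : Ω} (hω : c ω < M)
    (hb : 0 < b ω) : a ω = B₁ ∧ b ω = θ * B₁ := by
  have h1 : a ω = B₁ := by
    rw [← h.left_no_waste.1, Fintype.sum_eq_single ω]
    intro w hw
    rcases (h.coeff_le w).lt_or_eq with h1 | h1
    exacts [(h.other_nonsteep hω hb h1 hw).1, h.left_steep h1]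
  exact ⟨h1, h1 ▸ (h.shared_nonsteep hω hb).2.1⟩

/-- Otherwise the first player could move his whole budget from `ω` to `w`, where it would earn
more, shared or not. -/
lemma lt_steep_of_shared (h : FarEquilibrium θ B₁ B₂ M c a b) {ω w : Ω} (hω : c ω < M)
    (hb : 0 < b ω) (hw : c w = M) : B₁ < θ * b w := by
  by_contra! hle
  have hθ := h.pos
  have hθ₁ := h.lt_one
  have hB := h.budget_pos
  have hc := h.coeff_pos ω
  obtain ⟨h1, h2⟩ := h.left_eq_budget hω hb
  have hne : ω ≠ w := by rintro rfl; linarith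
  have haw := h.left_steep hw
  have h3 := h.left.transfer hne (h.left.nonneg ω) le_rfl
  rw [sub_self, equalShare_zero_left hθ (h.right.nonneg ω), haw, zero_add,
    equalShare_zero_left hθ (h.right.nonneg w), h1, h2, hw,
    equalShare_of_le_of_le (x := B₁) (y := θ * B₁) (by nlinarith) le_rfl] at h3
  rcases le_or_gt (θ * B₁) (b w) with h4 | h4
  · rw [equalShare_of_le_of_le hle h4] at h3
    nlinarith
  · rw [equalShare_of_gt hθ hθ₁ hB.le h4] at h3
    nlinarith [h.right.nonneg w, mul_pos hc hB]

/-- Summing `B₁ < θ * b w` over the `k` steep projects, which together get `B₂ - θ * B₁`. -/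
lemma budget_lt_of_shared (h : FarEquilibrium θ B₁ B₂ M c a b) {ω : Ω} (hω : c ω < M)
    (hb : 0 < b ω) {k : ℕ} (hcard : (Finset.univ.filter fun ω => c ω = M).card = k) :
    B₁ * (k + θ ^ 2) < θ * B₂ := by
  have hθ := h.pos
  have h1 : ∑ w ∈ Finset.univ.filter (fun w => c w = M), b w = B₂ - θ * B₁ := by
    rw [← h.right_no_waste.1, ← Finset.sum_filter_add_sum_filter_not Finset.univ (fun w => c w = M),
      ← (h.left_eq_budget hω hb).2, Finset.sum_eq_single_of_mem (s := Finset.univ.filter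
        fun w => ¬ c w = M) ω (by simpa using hω.ne), add_sub_cancel_right]
    intro w hw hne
    exact (h.other_nonsteep hω hb (lt_of_le_of_ne (h.coeff_le w)
      (by simpa using hw)) hne).2.1
  obtain ⟨w₀, hw₀⟩ := h.exists_steep
  have h2 : ∑ w ∈ Finset.univ.filter (fun w => c w = M), B₁ <
      ∑ w ∈ Finset.univ.filter (fun w => c w = M), θ * b w :=
    Finset.sum_lt_sum_of_nonempty ⟨w₀, by simpa using hw₀⟩ fun w hw =>
      h.lt_steep_of_shared hω hb (by simpa using hw)
  rw [Finset.sum_const, hcard, nsmul_eq_mul, ← Finset.mul_sum, h1] at h2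
  nlinarith

lemma sum_of_shared (h : FarEquilibrium θ B₁ B₂ M c a b) {ω : Ω} (hω : c ω < M)
    (hb : 0 < b ω) :
    ∑ w, c w * (a w + b w) = M * (B₂ - θ * B₁) + c ω * (B₁ * (1 + θ)) := by
  obtain ⟨h1, h2⟩ := h.left_eq_budget hω hb
  have h3 : ∀ w, c w * (a w + b w) = M * b w +
      if w = ω then c ω * (B₁ * (1 + θ)) - M * (θ * B₁) else 0 := by
    intro w
    split_ifs with hw
    · rw [hw, h1, h2]; ring
    · rcases (h.coeff_le w).lt_or_eq with h4 | h4
      · obtain ⟨h5, h6, -⟩ := h.other_nonsteep hω hb h4 hw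
        rw [h5, h6]; ring
      · rw [h.left_steep h4, h4]; ring
  rw [Finset.sum_congr rfl fun w _ => h3 w, Finset.sum_add_distrib, ← Finset.mul_sum,
    h.right_no_waste.1, Finset.sum_ite_eq', if_pos (Finset.mem_univ _)]
  ring

lemma left_eq_zero_of_lt (h : FarEquilibrium θ B₁ B₂ M c a b) (hb : ∀ w, c w < M → b w = 0)
    {ω w : Ω} (hω : c ω < M) (hw : c w < c ω) : a w = 0 := by
  by_contra ha0
  have ha := lt_of_le_of_ne (h.left.nonneg w) (Ne.symm ha0)
  have hne : w ≠ ω := by rintro rfl; exact lt_irrefl _ hw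
  have h1 := h.left.transfer hne ha.le le_rfl
  rw [hb ω hω, hb w (hw.trans hω), sub_self, equalShare_zero_left h.pos le_rfl,
    equalShare_zero_right h.pos h.lt_one (h.left.nonneg ω),
    equalShare_zero_right h.pos h.lt_one ha.le,
    equalShare_zero_right h.pos h.lt_one (add_nonneg (h.left.nonneg ω) ha.le)] at h1
  nlinarith

lemma sum_of_not_shared (h : FarEquilibrium θ B₁ B₂ M c a b) (hb : ∀ w, c w < M → b w = 0)
    {ω : Ω} (hω : c ω < M) (hmax : ∀ w, c w < M → c w ≤ c ω) :
    ∑ w, c w * (a w + b w) = M * B₂ + c ω * B₁ := by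
  rw [← h.right_no_waste.1, ← h.left_no_waste.1, Finset.mul_sum, Finset.mul_sum,
    ← Finset.sum_add_distrib]
  refine Finset.sum_congr rfl fun w _ => ?_
  rcases (h.coeff_le w).lt_or_eq with h4 | h4
  · rw [hb w h4]
    rcases (hmax w h4).lt_or_eq with h5 | h5
    · rw [h.left_eq_zero_of_lt hb hω h5]; ring
    · rw [h5]; ring
  · rw [h.left_steep h4, h4]; ring

/-- If the second player leaves the project `ω` to the first one, then she gains neither by
joining the first player nor by expelling him. -/
lemma le_of_not_shared (h : FarEquilibrium θ B₁ B₂ M c a b) (hb : ∀ w, c w < M → b w = 0)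
    {ω : Ω} (hω : c ω < M) (ha : 0 < a ω) :
    c ω * (1 + θ) ≤ M ∧ c ω * (1 + θ) ≤ 2 * θ * M := by
  have hθ := h.pos
  have hθ₁ := h.lt_one
  have hbω := hb ω hω
  constructor
  · have h1 := h.raise_le (ω₀ := ω) (by rw [hbω, mul_zero]; exact ha.le)
    rw [hbω, equalShare_zero_left hθ ha.le] at h1
    have h7 : a ω = θ * (a ω / θ) := (mul_div_cancel₀ _ hθ.ne').symm
    set q := a ω / θ with hq
    have hqpos : 0 < q := div_pos ha hθ
    refine le_of_mul_le_mul_right ?_ hqpos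
    rw [h7] at h1
    linarith
  · have haB : a ω ≤ B₁ := (Finset.single_le_sum (fun w _ => h.left.nonneg w)
      (Finset.mem_univ ω)).trans h.left.sum_le
    have hB₁ := h.budget_pos
    have hfar := h.far
    have hB₂ : 0 < B₂ := by
      by_contra! h5
      nlinarith
    -- The entry fee `θ * a ω` is raised by scaling down `b` uniformly; all of `b` lies on steep
    -- projects without the first player, so each unit costs exactly `M`.
    set t := θ * a ω / B₂ with ht
    have htB : t * B₂ = θ * a ω := by rw [ht]; field_simp
    have ht₀ : 0 ≤ t := by positivity
    have ht₁ : t ≤ 1 := by rw [ht, div_le_one hB₂]; nlinarith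
    set z : Ω → ℝ := fun w => b w - t * b w + if w = ω then θ * a ω else 0 with hz
    have hz₀ : ∀ w, 0 ≤ z w := fun w => by
      refine add_nonneg ?_ (by split_ifs <;> positivity)
      nlinarith [h.right.nonneg w]
    have hzω : z ω = θ * a ω := by simp [hz, hbω]
    have h1 := h.right.lagrangian_le M z hz₀
      (by simp [hz, Finset.sum_add_distrib, ← Finset.mul_sum, h.right_no_waste.1, htB]) ω
      (fun w hw => ?_)
    · have hθa : θ * a ω ≤ a ω := mul_le_of_le_one_left ha.le hθ₁.le
      rw [hzω, hbω, equalShare_of_le_of_le le_rfl (by nlinarith),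
        equalShare_zero_left hθ ha.le] at h1
      refine le_of_mul_le_mul_right ?_ ha
      linarith
    · have hzw : z w = b w - t * b w := by simp [hz, hw]
      rcases (h.coeff_le w).lt_or_eq with h4 | h4
      · rw [hzw, hb w h4]; simp
      · rw [h.left_steep h4, h4, equalShare_zero_right hθ hθ₁ (h.right.nonneg w),
          equalShare_zero_right hθ hθ₁ (hz₀ w)]
        linarith

end FarEquilibrium

end FarBudgets

/-! ### Existence of equilibria, certified by prices. -/

section Existence

variable {Ω : Type*} [Fintype Ω] {θ B B₁ B₂ M : ℝ} {c x y : Ω → ℝ}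

/-- An allocation that maximizes the Lagrangian at every project is a best response. -/
lemma isBestResponse_of_lagrangian (hx : ∀ ω, 0 ≤ x ω) (hxB : ∑ ω, x ω ≤ B) {l : ℝ} (hl : 0 ≤ l)
    (hslack : l * B ≤ l * ∑ ω, x ω)
    (hle : ∀ ω t, 0 ≤ t → t ≤ B → c ω * equalShare θ t (y ω) - l * t ≤
      c ω * equalShare θ (x ω) (y ω) - l * x ω) : IsBestResponse θ c B x y := by
  refine ⟨hx, hxB, fun z hz hzB => ?_⟩
  have h1 : ∑ ω, (c ω * equalShare θ (z ω) (y ω) - l * z ω) ≤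
      ∑ ω, (c ω * equalShare θ (x ω) (y ω) - l * x ω) := Finset.sum_le_sum fun ω _ =>
    hle ω (z ω) (hz ω) ((Finset.single_le_sum (fun w _ => hz w) (Finset.mem_univ ω)).trans hzB)
  rw [Finset.sum_sub_distrib, Finset.sum_sub_distrib, ← Finset.mul_sum, ← Finset.mul_sum] at h1
  nlinarith

/-- A pair of allocations that are best responses to each other. -/
def IsEquilibrium (θ : ℝ) (c : Ω → ℝ) (B₁ B₂ : ℝ) (a b : Ω → ℝ) : Prop :=
  IsBestResponse θ c B₁ a b ∧ IsBestResponse θ c B₂ b a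

lemma exists_isEquilibrium_even_even [Nonempty Ω] (hθ₀ : 0 < θ) (hB₁ : 0 < B₁) (hB : B₁ ≤ B₂)
    (hc : ∀ ω, 0 < c ω) (hcM : ∀ ω, c ω = M ∨ 2 * c ω ≤ M) {k : ℕ} (hk : 1 ≤ k)
    (hcard : (Finset.univ.filter fun ω => c ω = M).card = k)
    (hθB : θ * B₂ ≤ B₁) (hkB : k * θ * B₂ ≤ B₁) :
    ∃ a b, IsEquilibrium θ c B₁ B₂ a b := by
  have h0 : 0 ≤ k * θ := by positivity
  exact ⟨_, _, isBestResponse_even_even hθ₀ hc hcM hk hcard hB₁.le (hB₁.le.trans hB) hθB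
      (by nlinarith), isBestResponse_even_even hθ₀ hc hcM hk hcard (hB₁.le.trans hB) hB₁.le
      (by nlinarith) hkB⟩

lemma IsEquilibrium.sum_eq_of_close [DecidableEq Ω] {a b : Ω → ℝ}
    (h : IsEquilibrium θ c B₁ B₂ a b) (hθ₀ : 0 < θ) (hθ₁ : θ < 1) (hB₁ : 0 < B₁) (hB : B₁ ≤ B₂)
    (hc : ∀ ω, 0 < c ω) (hcM : ∀ ω, c ω = M ∨ 2 * c ω ≤ M) {ω₀ : Ω} (hω₀ : c ω₀ = M)
    (hθB : θ * B₂ ≤ B₁) : ∑ ω, c ω * (a ω + b ω) = M * (B₁ + B₂) := by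
  have : Nonempty Ω := ⟨ω₀⟩
  have hθB' : θ * B₁ ≤ B₂ := by nlinarith
  obtain ⟨h1, h2⟩ := h
  obtain ⟨h3, h4⟩ := h1.no_waste_of_le hθ₀ hc h2.nonneg h2.sum_le hB₁ hθB
  obtain ⟨h5, h6⟩ := h2.no_waste_of_le hθ₀ hc h1.nonneg h1.sum_le (hB₁.trans_le hB) hθB'
  rw [← h3, ← h5, ← Finset.sum_add_distrib, Finset.mul_sum]
  refine Finset.sum_congr rfl fun ω _ => ?_
  rcases hcM ω with hω | hω
  · rw [hω]
  · rw [h1.eq_zero_on_nonsteep h2 hθ₀ hθ₁ hc hcM hω₀ hθB hθB' h3 h5 h4 h6 hω,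
      h2.eq_zero_on_nonsteep h1 hθ₀ hθ₁ hc hcM hω₀ hθB' hθB h5 h3 h6 h4 hω]
    ring

variable [DecidableEq Ω]

/-- If `B₁ < θ B₂ / k`, there is an equilibrium in which the first player is alone on a most
valuable non-steep project, and the second player splits her budget over the steep ones. -/
lemma exists_isEquilibrium_separate (hθ₀ : 0 < θ) (hθ₁ : θ < 1) (hB₁ : 0 < B₁) (hB₂ : 0 < B₂)
    (hc : ∀ ω, 0 < c ω) (hcM : ∀ ω, c ω ≤ M) {k : ℕ} (hk : 1 ≤ k)
    (hcard : (Finset.univ.filter fun ω => c ω = M).card = k) {ω₀ : Ω} (hω₀ : c ω₀ < M)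
    (hmax : ∀ ω, c ω < M → c ω ≤ c ω₀) (hfar : B₁ < θ * B₂ / k)
    (h₁ : c ω₀ * (1 + θ) ≤ M) (h₂ : c ω₀ * (1 + θ) ≤ 2 * θ * M) :
    ∃ a b, IsEquilibrium θ c B₁ B₂ a b ∧
      ∑ ω, c ω * (a ω + b ω) = M * B₂ + c ω₀ * B₁ := by
  have hk0 : (0 : ℝ) < k := by exact_mod_cast hk
  have hM : 0 < M := (hc ω₀).trans hω₀
  set a : Ω → ℝ := fun ω => if ω = ω₀ then B₁ else 0 with ha
  set b : Ω → ℝ := fun ω => if c ω = M then B₂ / k else 0 with hb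
  have hbsum : ∑ ω, b ω = B₂ := by
    rw [hb, ← Finset.sum_filter, Finset.sum_const, hcard, nsmul_eq_mul]
    field_simp
  have hasum : ∑ ω, a ω = B₁ := by simp [ha]
  have hbns : ∀ ω, c ω < M → b ω = 0 := fun ω hω => by simp [hb, hω.ne]
  have hans : ∀ ω, c ω = M → a ω = 0 := fun ω hω => by
    have : ω ≠ ω₀ := by rintro rfl; linarith
    simp [ha, this]
  -- The first player's price is `c ω₀`, as `hfar` closes the steep projects to him. At price `M`,
  -- `h₂` makes joining him at `ω₀` unprofitable for the second player, and `h₁` excluding him.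
  refine ⟨a, b, ⟨isBestResponse_of_lagrangian (l := c ω₀)
      (fun ω => by simp only [ha]; split_ifs <;> linarith) hasum.le (hc ω₀).le (by rw [hasum])
      fun ω t ht htB => ?_, isBestResponse_of_lagrangian (l := M)
      (fun ω => by simp only [hb]; split_ifs <;> positivity) hbsum.le hM.le (by rw [hbsum])
      fun ω t ht htB => ?_⟩, ?_⟩
  · rcases (hcM ω).lt_or_eq with hω | hω
    · have h0 : 0 ≤ a ω := by simp only [ha]; split_ifs <;> linarith
      rw [hbns ω hω, equalShare_zero_right hθ₀ hθ₁ ht, equalShare_zero_right hθ₀ hθ₁ h0]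
      by_cases h1 : ω = ω₀
      · rw [h1]; linarith
      · simp only [ha, h1, if_false]
        nlinarith [hmax ω hω]
    · have h1 : b ω = B₂ / k := by simp [hb, hω]
      rw [hans ω hω, h1, equalShare_zero_left hθ₀ (by positivity),
        equalShare_of_lt (by rw [← mul_div_assoc]; linarith)]
      nlinarith [hc ω₀]
  · have h0 : 0 ≤ b ω := by simp only [hb]; split_ifs <;> positivity
    by_cases h1 : ω = ω₀
    · have h2 : a ω = B₁ := by simp [ha, h1]
      rw [h2, h1, hbns ω₀ hω₀, equalShare_zero_left hθ₀ hB₁.le]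
      have hc₀ := hc ω₀
      rcases lt_or_ge t (θ * B₁) with h3 | h3
      · rw [equalShare_of_lt h3]; nlinarith
      rcases lt_or_ge B₁ (θ * t) with h4 | h4
      · rw [equalShare_of_gt hθ₀ hθ₁ ht h4]
        nlinarith
      · rw [equalShare_of_le_of_le h3 h4]
        nlinarith
    · have h2 : a ω = 0 := by simp [ha, h1]
      rw [h2, equalShare_zero_right hθ₀ hθ₁ ht, equalShare_zero_right hθ₀ hθ₁ h0]
      rcases (hcM ω).lt_or_eq with hω | hω
      · rw [hbns ω hω]; nlinarith
      · rw [hω]; linarith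
  · rw [← hbsum, ← hasum, Finset.mul_sum, Finset.mul_sum, ← Finset.sum_add_distrib]
    refine Finset.sum_congr rfl fun ω _ => ?_
    rcases (hcM ω).lt_or_eq with hω | hω
    · rw [hbns ω hω]
      by_cases h1 : ω = ω₀
      · rw [h1]; ring
      · simp [ha, h1]
    · rw [hans ω hω, hω]; ring

/-- If `B₁ < θ B₂ / (k + θ²)`, there is an equilibrium in which the first player spends
everything on the most valuable non-steep project, and the second player contributes just enough
to get a share of it, and splits the rest of her budget over the steep projects. -/
lemma exists_isEquilibrium_joint (hθ₀ : 0 < θ) (hθ₁ : θ < 1) (hB₁ : 0 < B₁)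
    (hc : ∀ ω, 0 < c ω) (hcM : ∀ ω, c ω ≤ M) {k : ℕ} (hk : 1 ≤ k)
    (hcard : (Finset.univ.filter fun ω => c ω = M).card = k) {ω₀ : Ω} (hω₀ : c ω₀ < M)
    (hhalf : ∀ ω, c ω < M → ω ≠ ω₀ → 2 * c ω ≤ c ω₀) (hfar : B₁ * (k + θ ^ 2) < θ * B₂)
    (h₁ : 2 * θ * M ≤ c ω₀ * (1 + θ)) (h₂ : c ω₀ * (2 - θ) ≤ 2 * (1 - θ) * M) :
    ∃ a b, IsEquilibrium θ c B₁ B₂ a b ∧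
      ∑ ω, c ω * (a ω + b ω) = M * (B₂ - θ * B₁) + c ω₀ * (B₁ * (1 + θ)) := by
  have hk0 : (0 : ℝ) < k := by exact_mod_cast hk
  have hM : 0 < M := (hc ω₀).trans hω₀
  have hc₀ := hc ω₀
  set D := B₂ - θ * B₁ with hD
  have hBD : B₁ < θ * (D / k) := by
    rw [← mul_div_assoc, lt_div_iff₀ hk0]
    linarith
  have hDk : 0 < D / k := by
    by_contra! h
    nlinarith
  set a : Ω → ℝ := fun ω => if ω = ω₀ then B₁ else 0 with ha
  set b : Ω → ℝ := fun ω => (if c ω = M then D / k else 0) + if ω = ω₀ then θ * B₁ else 0 with hb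
  have hbsum : ∑ ω, b ω = B₂ := by
    rw [hb, Finset.sum_add_distrib, ← Finset.sum_filter, Finset.sum_const, hcard, nsmul_eq_mul,
      Finset.sum_ite_eq', if_pos (Finset.mem_univ _), mul_div_cancel₀ _ hk0.ne']
    linarith
  have hasum : ∑ ω, a ω = B₁ := by simp [ha]
  have hθB : 0 < θ * B₁ := mul_pos hθ₀ hB₁
  have hb₀ : ∀ ω, 0 ≤ b ω := fun ω => by
    refine add_nonneg ?_ ?_ <;> split_ifs <;> linarith
  have haω₀ : a ω₀ = B₁ := by simp [ha]
  have hbω₀ : b ω₀ = θ * B₁ := by simp [hb, hω₀.ne]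
  have haother : ∀ ω, ω ≠ ω₀ → a ω = 0 := fun ω hω => by simp [ha, hω]
  have hbns : ∀ ω, c ω < M → ω ≠ ω₀ → b ω = 0 := fun ω hω h1 => by simp [hb, hω.ne, h1]
  have hne : ∀ ω, c ω = M → ω ≠ ω₀ := by rintro ω hω rfl; linarith
  have hbs : ∀ ω, c ω = M → b ω = D / k := fun ω hω => by simp [hb, hω, hne ω hω]
  have hold : equalShare θ (θ * B₁) B₁ = (θ * B₁ + B₁) / 2 :=
    equalShare_of_le_of_le le_rfl (by nlinarith)
  -- With `t ≤ B₁` the first player cannot exclude a contribution `θ * B₁`, so his units at `ω₀`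
  -- earn `c ω₀ / 2`; `hhalf` says that no other non-steep project earns more.
  refine ⟨a, b, ⟨isBestResponse_of_lagrangian (l := c ω₀ / 2)
      (fun ω => by simp only [ha]; split_ifs <;> linarith) hasum.le (by positivity)
      (by rw [hasum]) fun ω t ht htB => ?_, isBestResponse_of_lagrangian (l := M)
      hb₀ hbsum.le hM.le (by rw [hbsum]) fun ω t ht htB => ?_⟩, ?_⟩
  · by_cases h1 : ω = ω₀
    · rw [h1, haω₀, hbω₀, equalShare_of_le_of_le (x := B₁) (by nlinarith) le_rfl]
      have := equalShare_le_half_add ht hθB.le (mul_le_mul_of_nonneg_left htB hθ₀.le)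
      nlinarith
    · rw [haother ω h1, equalShare_zero_left hθ₀ (hb₀ ω)]
      rcases (hcM ω).lt_or_eq with hω | hω
      · rw [hbns ω hω h1, equalShare_zero_right hθ₀ hθ₁ ht]
        nlinarith [hhalf ω hω h1]
      · rw [hbs ω hω, equalShare_of_lt (by linarith)]
        nlinarith
  · by_cases h1 : ω = ω₀
    · rw [h1, haω₀, hbω₀, hold]
      rcases lt_or_ge t (θ * B₁) with h3 | h3
      · rw [equalShare_of_lt h3]; nlinarith
      rcases lt_or_ge B₁ (θ * t) with h4 | h4
      · rw [equalShare_of_gt hθ₀ hθ₁ ht h4]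
        set q := B₁ / θ with hq
        have hBq : B₁ = θ * q := by rw [hq]; field_simp
        have hq₀ : 0 < q := div_pos hB₁ hθ₀
        have hqt : q < t := by
          rw [hBq] at h4
          exact lt_of_mul_lt_mul_left h4 hθ₀.le
        rw [hBq]
        have h5 : c ω₀ * (2 - θ) * (q * (1 + θ)) ≤ 2 * (1 - θ) * M * (q * (1 + θ)) :=
          mul_le_mul_of_nonneg_right h₂ (by positivity)
        nlinarith
      · rw [equalShare_of_le_of_le h3 h4]
        nlinarith
    · rw [haother ω h1, equalShare_zero_right hθ₀ hθ₁ ht, equalShare_zero_right hθ₀ hθ₁ (hb₀ ω)]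
      rcases (hcM ω).lt_or_eq with hω | hω
      · rw [hbns ω hω h1]; nlinarith
      · rw [hω]; linarith
  · have h3 : ∀ ω, c ω * (a ω + b ω) = M * b ω +
        if ω = ω₀ then c ω₀ * (B₁ * (1 + θ)) - M * (θ * B₁) else 0 := by
      intro ω
      split_ifs with h1
      · rw [h1, haω₀, hbω₀]; ring
      · rw [haother ω h1]
        rcases (hcM ω).lt_or_eq with hω | hω
        · rw [hbns ω hω h1]; ring
        · rw [hω]; ring
    rw [Finset.sum_congr rfl fun ω _ => h3 ω, Finset.sum_add_distrib, ← Finset.mul_sum, hbsum,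
      Finset.sum_ite_eq', if_pos (Finset.mem_univ _), hD]
    ring

omit [DecidableEq Ω] in
/-- If all projects are equal and the second player splits her budget evenly, then the first
player may do as he likes. -/
lemma isEquilibrium_of_const (hθ₀ : 0 < θ) (hθ₁ : θ < 1) (hM : 0 < M) [Nonempty Ω]
    (hB₂ : 0 < B₂) (hc : ∀ ω, c ω = M)
    (hfar : B₁ < θ * (B₂ / Fintype.card Ω)) {a : Ω → ℝ} (ha : ∀ ω, 0 ≤ a ω)
    (haB : ∑ ω, a ω ≤ B₁) : IsEquilibrium θ c B₁ B₂ a (fun _ => B₂ / Fintype.card Ω) := by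
  have hcard : (0 : ℝ) < Fintype.card Ω := by exact_mod_cast Fintype.card_pos
  have haω : ∀ ω, a ω ≤ B₁ := fun ω =>
    (Finset.single_le_sum (fun w _ => ha w) (Finset.mem_univ ω)).trans haB
  have hsum : ∑ _ω : Ω, B₂ / (Fintype.card Ω : ℝ) = B₂ := by
    rw [Finset.sum_const, Finset.card_univ, nsmul_eq_mul, mul_div_cancel₀ _ hcard.ne']
  have hpos : 0 ≤ B₂ / (Fintype.card Ω : ℝ) := by positivity
  -- The first player is excluded everywhere and earns nothing, so his price is `0` and he need not
  -- exhaust his budget.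
  refine ⟨isBestResponse_of_lagrangian (l := 0) ha haB le_rfl (by simp) fun ω t ht htB => ?_,
    isBestResponse_of_lagrangian (l := M) (fun _ => hpos) hsum.le hM.le (by rw [hsum])
      fun ω t ht htB => ?_⟩
  · rw [equalShare_of_lt (by linarith), equalShare_of_lt (by linarith [haω ω])]
    simp
  · have h1 := equalShare_le_add (θ := θ) ht (ha ω)
    rw [equalShare_of_gt hθ₀ hθ₁ hpos (by linarith [haω ω]), hc ω]
    nlinarith

end Existence

/-! ### From allocations back to the game. -/

lemma Fin.card_finset_two (s : Finset (Fin 2)) :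
    s.card = (if 0 ∈ s then 1 else 0) + if 1 ∈ s then 1 else 0 := by
  revert s; decide

namespace SharedEffortGame

variable {Ω : Type*} [Fintype Ω] {G : SharedEffortGame (Fin 2) Ω}

omit [Fintype Ω] in
lemma share_eq (h₁ : G.threshold < 1) {x : Fin 2 → Ω → ℝ}
    (hx : ∀ i ω, 0 ≤ x i ω) (ω : Ω) :
    G.share x 0 ω = G.coeff ω * equalShare G.threshold (x 0 ω) (x 1 ω) ∧
      G.share x 1 ω = G.coeff ω * equalShare G.threshold (x 1 ω) (x 0 ω) := by
  have hself : ∀ i, G.threshold * x i ω ≤ x i ω := fun i =>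
    mul_le_of_le_one_left (hx i ω) h₁.le
  have hmem₀ : 0 ∈ G.sharers x ω ↔ G.threshold * x 1 ω ≤ x 0 ω := by
    simp [sharers, Fin.forall_fin_two, hself]
  have hmem₁ : 1 ∈ G.sharers x ω ↔ G.threshold * x 0 ω ≤ x 1 ω := by
    simp [sharers, Fin.forall_fin_two, hself]
  have hcard := Fin.card_finset_two (G.sharers x ω)
  simp only [share, hmem₀, hmem₁, hcard, projectValue, Fin.sum_univ_two, equalShare]
  constructor <;> split_ifs <;> push_cast <;> ring

lemma utility_eq (h₁ : G.threshold < 1) {x : Fin 2 → Ω → ℝ}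
    (hx : ∀ i ω, 0 ≤ x i ω) :
    G.utility x 0 = ∑ ω, G.coeff ω * equalShare G.threshold (x 0 ω) (x 1 ω) ∧
      G.utility x 1 = ∑ ω, G.coeff ω * equalShare G.threshold (x 1 ω) (x 0 ω) :=
  ⟨Finset.sum_congr rfl fun ω _ => (share_eq h₁ hx ω).1,
    Finset.sum_congr rfl fun ω _ => (share_eq h₁ hx ω).2⟩

lemma welfare_eq (h₁ : G.threshold < 1) {x : Fin 2 → Ω → ℝ}
    (hx : ∀ i ω, 0 ≤ x i ω) : G.welfare x = ∑ ω, G.coeff ω * (x 0 ω + x 1 ω) := by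
  rw [welfare, Fin.sum_univ_two, (utility_eq h₁ hx).1, (utility_eq h₁ hx).2,
    ← Finset.sum_add_distrib]
  refine Finset.sum_congr rfl fun ω _ => ?_
  rw [← mul_add]
  congr 1
  have h2 := hx 0 ω
  have h3 := hx 1 ω
  unfold equalShare
  split_ifs <;> first | ring1 | nlinarith

lemma isNash_iff (h₁ : G.threshold < 1) {x : Fin 2 → Ω → ℝ} :
    G.IsNash x ↔
      IsEquilibrium G.threshold G.coeff (G.budget 0) (G.budget 1) (x 0) (x 1) := by
  constructor
  · rintro ⟨hx, hle⟩
    have hnn : ∀ i ω, 0 ≤ x i ω := fun i => (hx i).1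
    refine ⟨⟨hnn 0, (hx 0).2, fun z hz hzB => ?_⟩, ⟨hnn 1, (hx 1).2, fun z hz hzB => ?_⟩⟩
    · have h2 := hle 0 z ⟨hz, hzB⟩
      rw [(utility_eq h₁ hnn).1, (utility_eq h₁ (fun i => by
        fin_cases i
        · simpa using hz
        · simpa using hnn 1)).1] at h2
      simpa using h2
    · have h2 := hle 1 z ⟨hz, hzB⟩
      rw [(utility_eq h₁ hnn).2, (utility_eq h₁ (fun i => by
        fin_cases i
        · simpa using hnn 0
        · simpa using hz)).2] at h2
      simpa using h2
  · rintro ⟨ha, hb⟩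
    have hnn : ∀ i ω, 0 ≤ x i ω := Fin.forall_fin_two.2 ⟨ha.nonneg, hb.nonneg⟩
    refine ⟨Fin.forall_fin_two.2 ⟨⟨ha.nonneg, ha.sum_le⟩, ⟨hb.nonneg, hb.sum_le⟩⟩,
      Fin.forall_fin_two.2 ⟨fun z hz => ?_, fun z hz => ?_⟩⟩
    · rw [(utility_eq h₁ hnn).1, (utility_eq h₁ (fun i => by
        fin_cases i
        · simpa using hz.1
        · simpa using hnn 1)).1]
      simpa using ha.le z hz.1 hz.2
    · rw [(utility_eq h₁ hnn).2, (utility_eq h₁ (fun i => by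
        fin_cases i
        · simpa using hnn 0
        · simpa using hz.1)).2]
      simpa using hb.le z hz.1 hz.2

/-- An optimal profile spends everything on a project with the largest coefficient. -/
lemma isGreatest_welfare (h₁ : G.threshold < 1)
    (hB : ∀ i, 0 ≤ G.budget i) {ω₀ : Ω} (hpos : 0 ≤ G.coeff ω₀)
    (hmax : ∀ ω, G.coeff ω ≤ G.coeff ω₀) :
    IsGreatest (G.welfare '' G.profiles) (G.coeff ω₀ * (G.budget 0 + G.budget 1)) := by
  classical
  constructor
  · have hnn : ∀ i ω, 0 ≤ if ω = ω₀ then G.budget i else 0 := fun i ω => by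
      split_ifs; exacts [hB i, le_rfl]
    refine ⟨fun i ω => if ω = ω₀ then G.budget i else 0, fun i => ⟨hnn i, by simp⟩, ?_⟩
    rw [welfare_eq h₁ hnn, Fintype.sum_eq_single ω₀ fun ω hω => by simp [hω]]
    simp
  · rintro _ ⟨x, hx, rfl⟩
    have hnn : ∀ i ω, 0 ≤ x i ω := fun i => (hx i).1
    rw [welfare_eq h₁ hnn]
    calc ∑ ω, G.coeff ω * (x 0 ω + x 1 ω) ≤ ∑ ω, G.coeff ω₀ * (x 0 ω + x 1 ω) :=
          Finset.sum_le_sum fun ω _ => mul_le_mul_of_nonneg_right (hmax ω)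
            (add_nonneg (hnn 0 ω) (hnn 1 ω))
      _ = G.coeff ω₀ * (∑ ω, x 0 ω + ∑ ω, x 1 ω) := by
          rw [← Finset.mul_sum, Finset.sum_add_distrib]
      _ ≤ _ := mul_le_mul_of_nonneg_left (add_le_add (hx 0).2 (hx 1).2) hpos

/-- The price of anarchy, computed from the equilibria in terms of the players' allocations. -/
lemma isPriceOfAnarchy_of (h₁ : G.threshold < 1)
    (hB : ∀ i, 0 < G.budget i) {ω₀ : Ω} (hpos : 0 < G.coeff ω₀)
    (hmax : ∀ ω, G.coeff ω ≤ G.coeff ω₀) {w : ℝ}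
    (hex : ∃ a b, IsEquilibrium G.threshold G.coeff (G.budget 0) (G.budget 1) a b ∧
      ∑ ω, G.coeff ω * (a ω + b ω) = w)
    (hle : ∀ a b, IsEquilibrium G.threshold G.coeff (G.budget 0) (G.budget 1) a b →
      w ≤ ∑ ω, G.coeff ω * (a ω + b ω)) :
    G.IsPriceOfAnarchy (w / (G.coeff ω₀ * (G.budget 0 + G.budget 1))) := by
  refine ⟨w, _, ⟨?_, ?_⟩, isGreatest_welfare h₁ (fun i => (hB i).le) hpos.le hmax,
    mul_pos hpos (add_pos (hB 0) (hB 1)), rfl⟩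
  · obtain ⟨a, b, hab, hw⟩ := hex
    have hN : G.IsNash ![a, b] := (isNash_iff h₁).2 hab
    exact ⟨_, hN, (welfare_eq h₁ fun i => (hN.1 i).1).trans hw⟩
  · rintro _ ⟨x, hx, rfl⟩
    rw [welfare_eq h₁ fun i => (hx.1 i).1]
    exact hle _ _ ((isNash_iff h₁).1 hx)

/-- The price of stability, computed from the equilibria in terms of the players' allocations. -/
lemma isPriceOfStability_of (h₁ : G.threshold < 1)
    (hB : ∀ i, 0 < G.budget i) {ω₀ : Ω} (hpos : 0 < G.coeff ω₀)
    (hmax : ∀ ω, G.coeff ω ≤ G.coeff ω₀) {w : ℝ}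
    (hex : ∃ a b, IsEquilibrium G.threshold G.coeff (G.budget 0) (G.budget 1) a b ∧
      ∑ ω, G.coeff ω * (a ω + b ω) = w)
    (hle : ∀ a b, IsEquilibrium G.threshold G.coeff (G.budget 0) (G.budget 1) a b →
      ∑ ω, G.coeff ω * (a ω + b ω) ≤ w) :
    G.IsPriceOfStability (w / (G.coeff ω₀ * (G.budget 0 + G.budget 1))) := by
  refine ⟨w, _, ⟨?_, ?_⟩, isGreatest_welfare h₁ (fun i => (hB i).le) hpos.le hmax,
    mul_pos hpos (add_pos (hB 0) (hB 1)), rfl⟩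
  · obtain ⟨a, b, hab, hw⟩ := hex
    have hN : G.IsNash ![a, b] := (isNash_iff h₁).2 hab
    exact ⟨_, hN, (welfare_eq h₁ fun i => (hN.1 i).1).trans hw⟩
  · rintro _ ⟨x, hx, rfl⟩
    rw [welfare_eq h₁ fun i => (hx.1 i).1]
    exact hle _ _ ((isNash_iff h₁).1 hx)

end SharedEffortGame

/-! ### The dichotomy for far budgets. -/

/-- In an equilibrium with far budgets, either the second player shares the most valuable
non-steep project, or she leaves the non-steep projects to the first player. -/
lemma FarEquilibrium.shared_or_separate {Ω : Type*} [Fintype Ω] [DecidableEq Ω]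
    {θ B₁ B₂ M : ℝ} {c a b : Ω → ℝ} (h : FarEquilibrium θ B₁ B₂ M c a b) {ω₀ : Ω}
    (hω₀ : c ω₀ < M) (hmax : ∀ ω, c ω < M → c ω ≤ c ω₀) {k : ℕ}
    (hcard : (Finset.univ.filter fun ω => c ω = M).card = k) :
    ((B₁ * (k + θ ^ 2) < θ * B₂ ∧ (∀ ω, c ω < M → ω ≠ ω₀ → 2 * c ω ≤ c ω₀) ∧
        2 * θ * M ≤ c ω₀ * (1 + θ) ∧ c ω₀ * (2 - θ) ≤ 2 * (1 - θ) * M) ∧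
      ∑ ω, c ω * (a ω + b ω) = M * (B₂ - θ * B₁) + c ω₀ * (B₁ * (1 + θ))) ∨
    (((∀ ω, c ω < M → ω ≠ ω₀ → 2 * c ω ≤ c ω₀) →
        c ω₀ * (1 + θ) ≤ M ∧ c ω₀ * (1 + θ) ≤ 2 * θ * M) ∧
      ∑ ω, c ω * (a ω + b ω) = M * B₂ + c ω₀ * B₁) := by
  by_cases hb : ∀ ω, c ω < M → b ω = 0
  · refine Or.inr ⟨fun hhalf => h.le_of_not_shared hb hω₀ ?_, h.sum_of_not_shared hb hω₀ hmax⟩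
    have h1 : a ω₀ = B₁ := by
      rw [← h.left_no_waste.1, Fintype.sum_eq_single ω₀]
      intro w hw
      rcases (h.coeff_le w).lt_or_eq with h2 | h2
      · exact h.left_eq_zero_of_lt hb hω₀ (by linarith [hhalf w h2 hw, h.coeff_pos w])
      · exact h.left_steep h2
    exact h1 ▸ h.budget_pos
  · push Not at hb
    obtain ⟨ω, hω, hbω⟩ := hb
    have hbpos := lt_of_le_of_ne (h.right.nonneg ω) (Ne.symm hbω)
    have hωω₀ : ω = ω₀ := by
      by_contra hne
      linarith [(h.other_nonsteep hω hbpos hω₀ (Ne.symm hne)).2.2, hmax ω hω, h.coeff_pos ω₀]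
    subst hωω₀
    exact Or.inl ⟨⟨h.budget_lt_of_shared hω hbpos hcard,
      fun w hw hne => (h.other_nonsteep hω hbpos hw hne).2.2,
      (h.shared_nonsteep hω hbpos).2.2⟩, h.sum_of_shared hω hbpos⟩

/-! ### Conditions on the indices `1, …, m`. -/

section TwoPlayerGame

variable {θ B₁ B₂ : ℝ} {m k : ℕ} {α : ℕ → ℝ}

lemma steep_iff (hkm : k ≤ m)
    (hmono : ∀ i ∈ Finset.Icc 1 m, ∀ j ∈ Finset.Icc 1 m, i ≤ j → α i ≤ α j)
    (hsteep : ∀ j ∈ Finset.Icc (m - k + 1) m, α j = α m) (hnonsteep : k < m → α (m - k) < α m)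
    (ω : Finset.Icc 1 m) : α ω = α m ↔ m - k < (ω : ℕ) := by
  obtain ⟨j, hj⟩ := ω
  have hj' := Finset.mem_Icc.1 hj
  constructor
  · intro h
    by_contra h1
    replace h1 : j ≤ m - k := not_lt.1 h1
    have h2 := hmono j hj (m - k) (Finset.mem_Icc.2 (by omega)) h1
    have h3 := hnonsteep (by omega)
    simp only at h
    linarith
  · intro h
    simp only at h ⊢
    exact hsteep j (Finset.mem_Icc.2 (by omega))

lemma card_steep (hkm : k ≤ m)
    (hmono : ∀ i ∈ Finset.Icc 1 m, ∀ j ∈ Finset.Icc 1 m, i ≤ j → α i ≤ α j)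
    (hsteep : ∀ j ∈ Finset.Icc (m - k + 1) m, α j = α m) (hnonsteep : k < m → α (m - k) < α m) :
    (Finset.univ.filter fun ω : Finset.Icc 1 m => α ω = α m).card = k := by
  have h1 : (Finset.univ.filter fun ω : Finset.Icc 1 m => α ω = α m).map
      (Function.Embedding.subtype _) = Finset.Icc (m - k + 1) m := by
    ext j
    simp only [Finset.mem_map, Finset.mem_filter, Finset.mem_univ, true_and,
      Function.Embedding.subtype_apply, steep_iff hkm hmono hsteep hnonsteep, Finset.mem_Icc]
    constructor
    · rintro ⟨⟨i, hi⟩, h2, rfl⟩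
      have := Finset.mem_Icc.1 hi
      exact ⟨h2, this.2⟩
    · intro h2
      exact ⟨⟨j, Finset.mem_Icc.2 (by omega)⟩, h2.1, rfl⟩
  rw [← Finset.card_map, h1, Nat.card_Icc]
  omega

/-- Clearing denominators gives the form in which the equilibrium lemmas state the bounds. -/
lemma separateCase_iff (hθ₀ : 0 < θ) (hkm : k < m) (hα : 0 < α m) :
    SeparateCase θ B₁ B₂ m k α ↔ B₁ < θ * B₂ / k ∧ α (m - k) * (1 + θ) ≤ α m ∧
      α (m - k) * (1 + θ) ≤ 2 * θ * α m := by
  have h1 : 0 < 1 + θ := by linarith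
  rw [SeparateCase, le_min_iff, div_le_div_iff₀ hα h1, div_le_div_iff₀ hα h1, one_mul]
  exact and_iff_right hkm

/-- By monotonicity, `α (m - k - 1)` and uniqueness of the `2`-steep project control all other
non-steep projects. Conversely, the factor `2` and positivity rule out a second `2`-steep project.
-/
lemma jointCase_iff (hθ₀ : 0 < θ) (hθ₁ : θ < 1) (hkm : k < m)
    (hpos : ∀ j ∈ Finset.Icc 1 m, 0 < α j)
    (hmono : ∀ i ∈ Finset.Icc 1 m, ∀ j ∈ Finset.Icc 1 m, i ≤ j → α i ≤ α j)
    (hsteep : ∀ j ∈ Finset.Icc (m - k + 1) m, α j = α m) (hnonsteep : k < m → α (m - k) < α m) :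
    JointCase θ B₁ B₂ m k α ↔ B₁ * (k + θ ^ 2) < θ * B₂ ∧
      (∀ ω : Finset.Icc 1 m, α ω < α m → (ω : ℕ) ≠ m - k → 2 * α ω ≤ α (m - k)) ∧
      2 * θ * α m ≤ α (m - k) * (1 + θ) ∧ α (m - k) * (2 - θ) ≤ 2 * (1 - θ) * α m := by
  have hα : 0 < α m := hpos m (Finset.mem_Icc.2 (by omega))
  have hm : m ∈ Finset.Icc 1 m := Finset.mem_Icc.2 (by omega)
  have hmk : m - k ∈ Finset.Icc 1 m := Finset.mem_Icc.2 (by omega)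
  have hlt : ∀ ω : Finset.Icc 1 m, α ω < α m ↔ (ω : ℕ) ≤ m - k := fun ω => by
    rw [← not_lt, ← steep_iff hkm.le hmono hsteep hnonsteep ω]
    exact ⟨fun h => h.ne, fun h => lt_of_le_of_ne
      (hmono _ ω.2 _ hm (Finset.mem_Icc.1 ω.2).2) h⟩
  have hs : ∀ ω : Finset.Icc 1 m, ¬ (twoPlayerGame θ B₁ B₂ m α).IsSteep ω ↔ α ω < α m := by
    intro ω
    constructor
    · intro h1
      by_contra! h2
      exact h1 fun ω' => (hmono _ ω'.2 _ hm (Finset.mem_Icc.1 ω'.2).2).trans h2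
    · intro h1 h2
      exact not_le.2 h1 (h2 ⟨m, hm⟩)
  rw [JointCase, lt_div_iff₀ (by positivity), div_le_div_iff₀ (by linarith) hα,
    div_le_div_iff₀ hα (by linarith), and_iff_right hkm]
  constructor
  · rintro ⟨h1, h2, h3, h4, -⟩
    refine ⟨h1, fun ω hω hne => ?_, h3, h4⟩
    have h5 := (hlt ω).1 hω
    have h6 := (Finset.mem_Icc.1 ω.2).1
    refine le_trans ?_ (h2 (by omega))
    have := hmono _ ω.2 (m - k - 1) (Finset.mem_Icc.2 (by omega)) (by omega)
    linarith
  · rintro ⟨h1, h2, h3, h4⟩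
    refine ⟨h1, fun h5 => ?_, h3, h4, fun ω => ⟨fun h5 => ?_, fun h5 => ?_⟩⟩
    · have h6 : m - k - 1 ∈ Finset.Icc 1 m := Finset.mem_Icc.2 (by omega)
      exact h2 ⟨_, h6⟩ ((hlt _).2 (Nat.sub_le _ _)) (by simp only; omega)
    · by_contra hne
      have h6 : α (m - k) ≤ α ω := h5.2 ⟨m - k, hmk⟩ ((hs _).2 (hnonsteep hkm))
      linarith [h2 ω ((hs ω).1 h5.1) hne, hpos _ hmk]
    · refine ⟨(hs ω).2 (by rw [h5]; exact hnonsteep hkm), fun ω' hω' => ?_⟩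
      change α ω' ≤ α ω
      rw [h5]
      exact hmono _ ω'.2 _ hmk ((hlt ω').1 ((hs ω').1 hω'))

end TwoPlayerGame

/-! ### Assembly. -/

theorem mainTheorem2 (θ B₁ B₂ : ℝ) (m k : ℕ) (α : ℕ → ℝ)
    (hθ₀ : 0 < θ) (hθ₁ : θ < 1)
    (hB₁ : 0 < B₁) (hB : B₁ ≤ B₂)
    (hk : 1 ≤ k) (hkm : k ≤ m)
    (hpos : ∀ j ∈ Finset.Icc 1 m, 0 < α j)
    (hmono : ∀ i ∈ Finset.Icc 1 m, ∀ j ∈ Finset.Icc 1 m, i ≤ j → α i ≤ α j)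
    (hsteep : ∀ j ∈ Finset.Icc (m - k + 1) m, α j = α m)
    (hnonsteep : k < m → α (m - k) < α m) :
    -- close budgets
    (θ * B₂ ≤ B₁ → (k < m → α (m - k) ≤ 1 / 2 * α m) → k * θ * B₂ ≤ B₁ →
      (∃ x, (twoPlayerGame θ B₁ B₂ m α).IsNash x) ∧
      (twoPlayerGame θ B₁ B₂ m α).IsPriceOfStability 1 ∧
      (twoPlayerGame θ B₁ B₂ m α).IsPriceOfAnarchy 1) ∧
    -- far budgets
    (B₁ < θ * B₂ →
      (SeparateCase θ B₁ B₂ m k α →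
        (∃ x, (twoPlayerGame θ B₁ B₂ m α).IsNash x) ∧
        (twoPlayerGame θ B₁ B₂ m α).IsPriceOfStability
          ((α m * B₂ + α (m - k) * B₁) / (α m * (B₁ + B₂))) ∧
        (JointCase θ B₁ B₂ m k α →
          (twoPlayerGame θ B₁ B₂ m α).IsPriceOfAnarchy
            ((α m * (B₂ - θ * B₁) + α (m - k) * (B₁ * (1 + θ))) / (α m * (B₁ + B₂)))) ∧
        (¬ JointCase θ B₁ B₂ m k α →
          (twoPlayerGame θ B₁ B₂ m α).IsPriceOfAnarchy
            ((α m * B₂ + α (m - k) * B₁) / (α m * (B₁ + B₂))))) ∧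
      (JointCase θ B₁ B₂ m k α →
        (∃ x, (twoPlayerGame θ B₁ B₂ m α).IsNash x) ∧
        (SeparateCase θ B₁ B₂ m k α →
          (twoPlayerGame θ B₁ B₂ m α).IsPriceOfStability
            ((α m * B₂ + α (m - k) * B₁) / (α m * (B₁ + B₂)))) ∧
        (¬ SeparateCase θ B₁ B₂ m k α →
          (twoPlayerGame θ B₁ B₂ m α).IsPriceOfStability
            ((α m * (B₂ - θ * B₁) + α (m - k) * (B₁ * (1 + θ))) / (α m * (B₁ + B₂)))) ∧
        (twoPlayerGame θ B₁ B₂ m α).IsPriceOfAnarchy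
          ((α m * (B₂ - θ * B₁) + α (m - k) * (B₁ * (1 + θ))) / (α m * (B₁ + B₂)))) ∧
      (B₁ < θ / m * B₂ → α m = α 1 →
        (∃ x, (twoPlayerGame θ B₁ B₂ m α).IsNash x) ∧
        (twoPlayerGame θ B₁ B₂ m α).IsPriceOfStability 1 ∧
        (twoPlayerGame θ B₁ B₂ m α).IsPriceOfAnarchy (B₂ / (B₁ + B₂)))) := by
  have hm1 : 1 ≤ m := hk.trans hkm
  have hm : m ∈ Finset.Icc 1 m := Finset.mem_Icc.2 ⟨hm1, le_rfl⟩
  have hα : 0 < α m := hpos m hm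
  have hB₂ : 0 < B₂ := hB₁.trans_le hB
  have : Nonempty (Finset.Icc 1 m) := ⟨⟨m, hm⟩⟩
  set c : Finset.Icc 1 m → ℝ := fun j => α j with hc
  have hcpos : ∀ ω, 0 < c ω := fun ω => hpos _ ω.2
  have hcle : ∀ ω, c ω ≤ α m := fun ω => hmono _ ω.2 _ hm (Finset.mem_Icc.1 ω.2).2
  have hcard : (Finset.univ.filter fun ω => c ω = α m).card = k :=
    card_steep hkm hmono hsteep hnonsteep
  have hbudget : ∀ i, 0 < (twoPlayerGame θ B₁ B₂ m α).budget i :=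
    Fin.forall_fin_two.2 ⟨hB₁, hB₂⟩
  have hNash : ∀ {a b}, IsEquilibrium θ c B₁ B₂ a b →
      ∃ x, (twoPlayerGame θ B₁ B₂ m α).IsNash x := fun {a b} h =>
    ⟨![a, b], (SharedEffortGame.isNash_iff (G := twoPlayerGame θ B₁ B₂ m α) hθ₁).2 h⟩
  have hPoA : ∀ w : ℝ, (∃ a b, IsEquilibrium θ c B₁ B₂ a b ∧ ∑ ω, c ω * (a ω + b ω) = w) →
      (∀ a b, IsEquilibrium θ c B₁ B₂ a b → w ≤ ∑ ω, c ω * (a ω + b ω)) →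
      (twoPlayerGame θ B₁ B₂ m α).IsPriceOfAnarchy (w / (α m * (B₁ + B₂))) :=
    fun w => SharedEffortGame.isPriceOfAnarchy_of (G := twoPlayerGame θ B₁ B₂ m α) hθ₁
      hbudget (ω₀ := ⟨m, hm⟩) hα hcle
  have hPoS : ∀ w : ℝ, (∃ a b, IsEquilibrium θ c B₁ B₂ a b ∧ ∑ ω, c ω * (a ω + b ω) = w) →
      (∀ a b, IsEquilibrium θ c B₁ B₂ a b → ∑ ω, c ω * (a ω + b ω) ≤ w) →
      (twoPlayerGame θ B₁ B₂ m α).IsPriceOfStability (w / (α m * (B₁ + B₂))) :=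
    fun w => SharedEffortGame.isPriceOfStability_of (G := twoPlayerGame θ B₁ B₂ m α) hθ₁
      hbudget (ω₀ := ⟨m, hm⟩) hα hcle
  have hopt : 0 < α m * (B₁ + B₂) := mul_pos hα (add_pos hB₁ hB₂)
  refine ⟨fun hθB hhalf hkB => ?_, fun hfar => ?_⟩
  · have hcM : ∀ ω, c ω = α m ∨ 2 * c ω ≤ α m := by
      intro ω
      rw [or_iff_not_imp_left]
      intro h1
      have h2 : (ω : ℕ) ≤ m - k := by
        rw [← not_lt, ← steep_iff hkm hmono hsteep hnonsteep ω]; exact h1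
      have h3 := (Finset.mem_Icc.1 ω.2).1
      have h4 : c ω ≤ α (m - k) := hmono _ ω.2 _ (Finset.mem_Icc.2 (by omega)) h2
      linarith [hhalf (by omega)]
    obtain ⟨a, b, hab⟩ :=
      exists_isEquilibrium_even_even hθ₀ hB₁ hB hcpos hcM hk hcard hθB hkB
    have hsum : ∀ a b, IsEquilibrium θ c B₁ B₂ a b →
        ∑ ω, c ω * (a ω + b ω) = α m * (B₁ + B₂) := fun a b h =>
      h.sum_eq_of_close hθ₀ hθ₁ hB₁ hB hcpos hcM (ω₀ := ⟨m, hm⟩) rfl hθB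
    rw [← div_self hopt.ne']
    exact ⟨hNash hab, hPoS _ ⟨a, b, hab, hsum a b hab⟩ fun a b h => (hsum a b h).le,
      hPoA _ ⟨a, b, hab, hsum a b hab⟩ fun a b h => (hsum a b h).ge⟩
  have hexSeparate : SeparateCase θ B₁ B₂ m k α → ∃ a b, IsEquilibrium θ c B₁ B₂ a b ∧
      ∑ ω, c ω * (a ω + b ω) = α m * B₂ + α (m - k) * B₁ := fun hS => by
    have hlt := hS.1
    have hmk : m - k ∈ Finset.Icc 1 m := Finset.mem_Icc.2 (by omega)
    obtain ⟨h1, h2, h3⟩ := (separateCase_iff hθ₀ hlt hα).1 hS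
    exact exists_isEquilibrium_separate hθ₀ hθ₁ hB₁ hB₂ hcpos hcle hk hcard
      (ω₀ := ⟨m - k, hmk⟩) (hnonsteep hlt) (fun ω hω => hmono _ ω.2 _ hmk (by
        rw [← not_lt, ← steep_iff hkm hmono hsteep hnonsteep ω]; exact hω.ne)) h1 h2 h3
  have hexJoint : JointCase θ B₁ B₂ m k α → ∃ a b, IsEquilibrium θ c B₁ B₂ a b ∧
      ∑ ω, c ω * (a ω + b ω) =
        α m * (B₂ - θ * B₁) + α (m - k) * (B₁ * (1 + θ)) := fun hJ => by
    have hlt := hJ.1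
    have hmk : m - k ∈ Finset.Icc 1 m := Finset.mem_Icc.2 (by omega)
    obtain ⟨h1, h2, h3, h4⟩ :=
      (jointCase_iff hθ₀ hθ₁ hlt hpos hmono hsteep hnonsteep).1 hJ
    exact exists_isEquilibrium_joint hθ₀ hθ₁ hB₁ hcpos hcle hk hcard
      (ω₀ := ⟨m - k, hmk⟩) (hnonsteep hlt)
      (fun ω hω hne => h2 ω hω fun h => hne (Subtype.ext h)) h1 h3 h4
  have hdich : k < m → ∀ a b, IsEquilibrium θ c B₁ B₂ a b →
      (JointCase θ B₁ B₂ m k α ∧ ∑ ω, c ω * (a ω + b ω) =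
        α m * (B₂ - θ * B₁) + α (m - k) * (B₁ * (1 + θ))) ∨
      ((JointCase θ B₁ B₂ m k α → SeparateCase θ B₁ B₂ m k α) ∧
        ∑ ω, c ω * (a ω + b ω) = α m * B₂ + α (m - k) * B₁) := fun hlt a b hab => by
    have hmk : m - k ∈ Finset.Icc 1 m := Finset.mem_Icc.2 (by omega)
    have hF : FarEquilibrium θ B₁ B₂ (α m) c a b := ⟨hθ₀, hθ₁, hB₁, hfar, hcpos, hcle,
      ⟨⟨m, hm⟩, rfl⟩, ⟨⟨m - k, hmk⟩, hnonsteep hlt⟩, hab.1, hab.2⟩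
    rw [jointCase_iff hθ₀ hθ₁ hlt hpos hmono hsteep hnonsteep, separateCase_iff hθ₀ hlt hα]
    rcases hF.shared_or_separate (ω₀ := ⟨m - k, hmk⟩) (hnonsteep hlt) (fun ω hω =>
      hmono _ ω.2 _ hmk (by
        rw [← not_lt, ← steep_iff hkm hmono hsteep hnonsteep ω]; exact hω.ne)) hcard with
      ⟨⟨h1, h2, h3⟩, h4⟩ | ⟨h1, h2⟩
    · exact Or.inl ⟨⟨h1, fun ω hω hne => h2 ω hω fun h => hne (congrArg Subtype.val h), h3⟩, h4⟩
    · refine Or.inr ⟨fun ⟨h3, h4, _⟩ => ⟨?_, h1 fun ω hω hne =>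
        h4 ω hω fun h => hne (Subtype.ext h)⟩, h2⟩
      have hk0 : (0 : ℝ) < k := by exact_mod_cast hk
      rw [lt_div_iff₀ hk0]
      -- The budget bound with `k + θ ^ 2` implies the one with `k`.
      nlinarith [mul_pos hB₁ (pow_pos hθ₀ 2)]
  -- A shared equilibrium diverts `θ * B₁` from steep projects to `m - k`, so its welfare is the
  -- lower one.
  have hR : k < m → α m * (B₂ - θ * B₁) + α (m - k) * (B₁ * (1 + θ)) ≤
      α m * B₂ + α (m - k) * B₁ := fun hlt => by
    nlinarith [mul_pos (mul_pos hθ₀ hB₁) (sub_pos.2 (hnonsteep hlt))]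
  have hPoSR : SeparateCase θ B₁ B₂ m k α → (twoPlayerGame θ B₁ B₂ m α).IsPriceOfStability
      ((α m * B₂ + α (m - k) * B₁) / (α m * (B₁ + B₂))) := fun hS =>
    hPoS _ (hexSeparate hS) fun a b hab => by
      rcases hdich hS.1 a b hab with h | h
      exacts [h.2.trans_le (hR hS.1), h.2.le]
  have hPoAR' : JointCase θ B₁ B₂ m k α → (twoPlayerGame θ B₁ B₂ m α).IsPriceOfAnarchy
      ((α m * (B₂ - θ * B₁) + α (m - k) * (B₁ * (1 + θ))) / (α m * (B₁ + B₂))) := fun hJ =>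
    hPoA _ (hexJoint hJ) fun a b hab => by
      rcases hdich hJ.1 a b hab with h | h
      exacts [h.2.ge, (hR hJ.1).trans h.2.ge]
  refine ⟨fun hS => ?_, fun hJ => ?_, fun hfar' hconst => ?_⟩
  · obtain ⟨a, b, hab, -⟩ := hexSeparate hS
    refine ⟨hNash hab, hPoSR hS, hPoAR', fun hJ => hPoA _ (hexSeparate hS) fun a b hab => ?_⟩
    rcases hdich hS.1 a b hab with h | h
    exacts [absurd h.1 hJ, h.2.ge]
  · obtain ⟨a, b, hab, -⟩ := hexJoint hJ
    refine ⟨hNash hab, hPoSR, fun hS => hPoS _ (hexJoint hJ) fun a b hab => ?_, hPoAR' hJ⟩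
    rcases hdich hJ.1 a b hab with h | h
    exacts [h.2.le, absurd (h.1 hJ) hS]
  · have hcM : ∀ ω, c ω = α m := fun ω => le_antisymm (hcle ω) (hconst.trans_le
      (hmono 1 (Finset.mem_Icc.2 ⟨le_rfl, hm1⟩) _ ω.2 (Finset.mem_Icc.1 ω.2).1))
    have hcardΩ : Fintype.card (Finset.Icc 1 m) = m := by simp
    have hfarΩ : B₁ < θ * (B₂ / Fintype.card (Finset.Icc 1 m)) := by
      rw [hcardΩ, mul_div_left_comm, mul_comm]; exact hfar'
    have hEq := fun {a} => isEquilibrium_of_const (a := a) hθ₀ hθ₁ hα hB₂ hcM hfarΩ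
    have hsum : ∀ a b : Finset.Icc 1 m → ℝ,
        ∑ ω, c ω * (a ω + b ω) = α m * (∑ ω, a ω + ∑ ω, b ω) := fun a b => by
      rw [← Finset.sum_add_distrib, Finset.mul_sum]
      exact Finset.sum_congr rfl fun ω _ => by rw [hcM]
    have hbsum : ∑ _ω : Finset.Icc 1 m, B₂ / (Fintype.card (Finset.Icc 1 m) : ℝ) = B₂ := by
      rw [Finset.sum_const, Finset.card_univ, nsmul_eq_mul, mul_div_cancel₀]
      exact_mod_cast Fintype.card_ne_zero
    -- An idle first player gives the worst welfare; spending all of `B₁` on a project gives the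
    -- optimum.
    have hzero := hEq (a := fun _ => 0) (fun _ => le_rfl) (by simpa using hB₁.le)
    refine ⟨hNash hzero, ?_, ?_⟩
    · rw [← div_self hopt.ne']
      refine hPoS _ ⟨fun ω => if ω = ⟨m, hm⟩ then B₁ else 0, _,
        hEq (fun ω => by split_ifs <;> linarith) (by simp), ?_⟩ fun a b hab => ?_
      · rw [hsum, hbsum]; simp
      · rw [hsum]
        exact mul_le_mul_of_nonneg_left (add_le_add hab.1.sum_le hab.2.sum_le) hα.le
    · rw [← mul_div_mul_left B₂ _ hα.ne']
      refine hPoA _ ⟨_, _, hzero, by rw [hsum, hbsum]; simp⟩ fun a b hab => ?_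
      have h1 := (hab.2.no_waste_of_le hθ₀ hcpos hab.1.nonneg hab.1.sum_le hB₂
        (by nlinarith)).1
      rw [hsum, h1]
      exact mul_le_mul_of_nonneg_left (le_add_of_nonneg_left
        (Finset.sum_nonneg fun ω _ => hab.1.nonneg ω)) hα.le
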